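/- **Setting.** Let $\mathcal G$ be a DAG on $[n]$ with parent sets $\mathrm{Pa}(i)$. The latent vector $Z=(Z_1,\dots,Z_n)$ has density $p(z)=\prod_i p_i(z_i\mid z_{\mathrm{Pa}(i)})$ with continuously differentiable, everywhere positive conditional densities $p_i$. For each node $i$ there are two hard interventional mechanisms, with continuously differentiable, everywhere positive densities $q_i,\tilde q_i$ on $\mathbb R$. For an unknown permutation $I$ of $[n]$ there are coupled environments $\mathcal E^m,\tilde{\mathcal E}^m$ ($m\in[n]$), both intervening on the node $\ell=I^m$: the density of $Z$ is $p^m(z)=q_\ell(z_\ell)\prod_{i\ne\ell}p_i(z_i\mid z_{\mathrm{Pa}(i)})$ in $\mathcal E^m$ and $\tilde p^m(z)=\tilde q_\ell(z_\ell)\prod_{i\ne\ell}p_i(z_i\mid z_{\mathrm{Pa}(i)})$ in $\tilde{\mathcal E}^m$. One observes $X=g(Z)\in\mathbb R^d$, where $g:\mathbb R^n\to\mathbb R^d$ is an unknown $C^1$ diffeomorphism onto its image $\mathcal X$. The *interventional data* are $\mathcal X$ and the laws of $X$ in the environments $\mathcal E^m,\tilde{\mathcal E}^m$, $m\in[n]$;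 neither $I$ nor the observational law of $X$ is available. *Perfect latent recovery* by a map $h$ from the observation space to $\mathbb R^n$ means that there are a permutation $\pi$ and $C^1$ diffeomorphisms $\varphi_i$ of $\mathbb R$ with $[h(g(z))]_i=\varphi_{\pi_i}(z_{\pi_i})$ for all $z\in\mathbb R^n$ and $i\in[n]$. *Perfect DAG recovery* by a directed graph $\hat{\mathcal G}$ on $[n]$ means that $\hat{\mathcal G}$ is isomorphic to $\mathcal G$. A *valid encoder* is a $C^1$ diffeomorphism $h$ of $\mathcal X$ onto $\mathbb R^n$; write $\hat Z=h(X)$, and let $D_{\rm t}(h)$ be the $n\times n$ matrix with entries $[D_{\rm t}(h)]_{i,m}=\mathbb E\,\bigl|[s^m_{\hat Z}(\hat Z)-\tilde s^m_{\hat Z}(\hat Z)]_i\bigr|\in[0,\infty]$, where $s^m_{\hat Z}-\tilde s^m_{\hat Z}$ is the difference of the score functions of $\hat Z$ in $\mathcal E^m$ and $\tilde{\mathcal E}^m$ (the gradient of the difference of the log-densities), and the expectation is taken in $\mathcal E^m$. An *optimal encoder* is a valid encoder that minimizes the number of nonzero entries of $D_{\rm t}(h)$ among the valid encoders for which $D_{\rm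 t}(h)$ is diagonal. **Theorem (No Observational Data).** Suppose that for every $i\in[n]$ the pair $(q_i,\tilde q_i)$ satisfies interventional discrepancy: $\frac{d}{du}\frac{q_i(u)}{\tilde q_i(u)}\neq 0$ for all $u$ outside a Lebesgue null set. Then the interventional data suffice to 1. (Identifiability) perfectly recover the latent DAG, if moreover the latent causal model has additive noise ($Z_i=f_i(Z_{\mathrm{Pa}(i)})+N_i$ with noise densities of full support), $p$ is twice differentiable, and $p$ is adjacency-faithful (if $i,j$ are adjacent in $\mathcal G$, then $Z_i,Z_j$ are dependent conditionally on every subset of $\{Z_\ell:\ell\notin\{i,j\}\}$); 2. (Identifiability) perfectly recover the latent variables; 3. (Achievability) achieve the two guarantees by a procedure that uses only the interventional data. In 1 and 2, this means that there are fixed maps, from interventional data to estimators of $Z$ and to directed graphs on $[n]$, that succeed for all such models. In 3, the procedure is the following. An optimal encoder exists, and every optimal encoder $h$ gives perfect latent recovery. Under the additional hypotheses of 1, the graph $\hat{\mathcal G}$ constructed as follows gives perfect DAG recovery. For $i\neq j$ let $P_{ij}$ be the set of the coordinates in which the score of $\hat Z$ differs with positive probability between $\mathcal E^i$ and $\tilde{\mathcal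 E}^j$ or between $\mathcal E^j$ and $\tilde{\mathcal E}^i$, and let $\mathcal B_i=\bigcap_{j\neq i}P_{ij}$. Call $i$ a *declared root* if for some $j\neq i$ with $|P_{ij}|=2$ either $\hat Z_i,\hat Z_j$ are dependent in $\mathcal E^i$, or they are independent both in $\mathcal E^i$ and in $\tilde{\mathcal E}^j$. Put $k\to j$ in $\hat{\mathcal G}$ if $k\in\mathcal B_j\setminus\{j\}$ and one of the following holds: (a) at least two of the sets $\mathcal B_i$ are singletons; (b) $j$ is not a declared root and, in case $k$ is the only declared root, $\hat Z_k$ and $\hat Z_j$ are dependent in $\mathcal E^k$ given $\{\hat Z_\ell:\ell\in\mathcal B_j\setminus\{j,k\}\}$. -/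

import Mathlib

open MeasureTheory ProbabilityTheory
open scoped ENNReal

namespace CausalRep

noncomputable section

/-! ### Densities, scores and conditional independence on `ℝⁿ` -/

/-- A continuously differentiable, everywhere positive probability density on `ℝ`. -/
structure IsSmoothPosPDF (f : ℝ → ℝ) : Prop where
  contDiff : ContDiff ℝ 1 f
  pos : ∀ u, 0 < f u
  lintegral_eq_one : ∫⁻ u, ENNReal.ofReal (f u) = 1

/-- Interventional discrepancy of two densities on `ℝ`: the derivative of their ratio is nonzero
outside a Lebesgue null set. -/
def InterventionalDiscrepancy (p q : ℝ → ℝ) : Prop :=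
  ∃ T : Set ℝ, volume T = 0 ∧ ∀ u, u ∉ T → deriv (fun v => p v / q v) u ≠ 0

/-- `f` is a continuous probability density function of `μ` with respect to Lebesgue measure.
There is at most one such `f`. -/
def IsContinuousPDF {n : ℕ} (μ : Measure (Fin n → ℝ)) (f : (Fin n → ℝ) → ℝ) : Prop :=
  Continuous f ∧ (∀ z, 0 ≤ f z) ∧ μ = volume.withDensity (fun z => ENNReal.ofReal (f z))

open Classical in
/-- The continuous probability density function of `μ` (zero if there is none). -/
def contPDF {n : ℕ} (μ : Measure (Fin n → ℝ)) : (Fin n → ℝ) → ℝ :=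
  if h : ∃ f, IsContinuousPDF μ f then h.choose else 0

/-- The `i`-th coordinate at `z` of the difference of the score functions of `μ` and `ν`, that is,
the `i`-th coordinate of `∇ (log p_μ - log p_ν)`.  It equals `[∇ log p_μ - ∇ log p_ν]_i` whenever
both scores exist, and it also makes sense when only the log-ratio is differentiable, as happens
for images of smooth densities under maps that are merely `C¹`. -/
def scoreDiff {n : ℕ} (μ ν : Measure (Fin n → ℝ)) (i : Fin n) (z : Fin n → ℝ) : ℝ :=
  fderiv ℝ (fun y => Real.log (contPDF μ y) - Real.log (contPDF ν y)) z (Pi.single i 1)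

/-- The expected absolute score change in coordinate `i`, `E_{Z ∼ μ} |[s_μ(Z) - s_ν(Z)]_i|`, as a
number in `[0, ∞]`. -/
def scoreChange {n : ℕ} (μ ν : Measure (Fin n → ℝ)) (i : Fin n) : ℝ≥0∞ :=
  ∫⁻ z, ‖scoreDiff μ ν i z‖ₑ ∂μ

/-- Under the finite measure `μ` on `ℝⁿ`, the coordinates `i` and `j` are conditionally
independent given the coordinates in `S`. -/
def CoordCondIndep {n : ℕ} (μ : Measure (Fin n → ℝ)) (i j : Fin n) (S : Set (Fin n)) : Prop :=
  ∃ _ : IsFiniteMeasure μ,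
    CondIndepFun
      (MeasurableSpace.comap (fun (z : Fin n → ℝ) (l : S) => z l) inferInstance)
      (measurable_pi_lambda _ fun l : S => measurable_pi_apply (l : Fin n)).comap_le
      (fun z : Fin n → ℝ => z i) (fun z : Fin n → ℝ => z j) μ

/-! ### The latent causal model and the generation of the observed variables -/

/-- A directed acyclic graph on `n` nodes, given by its parent sets. -/
structure DAG (n : ℕ) where
  pa : Fin n → Finset (Fin n)
  acyclic : ∀ i, ¬ Relation.TransGen (fun j k => j ∈ pa k) i i

/-- The underlying directed graph, with an edge `i → j` if `i` is a parent of `j`. -/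
def DAG.toDigraph {n : ℕ} (G : DAG n) : Digraph (Fin n) where
  Adj i j := i ∈ G.pa j

/-- A latent causal model on `n` nodes with two hard interventional mechanisms per node and two
coupled families of single-node interventional environments, together with a transformation of
the latent space `ℝⁿ` into the observation space `ℝᵈ`. -/
structure Model (n d : ℕ) where
  /-- the latent graph -/
  graph : DAG n
  /-- the observational mechanisms `p_i (z_i | z_{Pa i})` -/
  mech : ∀ i : Fin n, ℝ → (graph.pa i → ℝ) → ℝ
  mech_contDiff : ∀ i, ContDiff ℝ 1 (fun x : ℝ × (graph.pa i → ℝ) => mech i x.1 x.2)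
  mech_pdf : ∀ i w, IsSmoothPosPDF (fun u => mech i u w)
  /-- the first hard interventional mechanisms `q_i` -/
  q : Fin n → ℝ → ℝ
  q_pdf : ∀ i, IsSmoothPosPDF (q i)
  /-- the second hard interventional mechanisms `q̃_i` -/
  q' : Fin n → ℝ → ℝ
  q'_pdf : ∀ i, IsSmoothPosPDF (q' i)
  /-- `target m` is the node intervened in both environments number `m` -/
  target : Equiv.Perm (Fin n)
  /-- the transformation, a `C¹` diffeomorphism onto its image (hence `n ≤ d`) -/
  g : (Fin n → ℝ) → (Fin d → ℝ)
  /-- the inverse of the transformation on its image -/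
  gInv : (Fin d → ℝ) → (Fin n → ℝ)
  g_contDiff : ContDiff ℝ 1 g
  gInv_contDiffOn : ContDiffOn ℝ 1 gInv (Set.range g)
  gInv_g : ∀ z, gInv (g z) = z

namespace Model

variable {n d : ℕ} (M : Model n d)

/-- The observational density `p(z) = ∏ i, p_i (z_i | z_{Pa i})` of the latent variables. -/
def pdf (z : Fin n → ℝ) : ℝ :=
  ∏ i, M.mech i (z i) (fun j => z j)

/-- The latent density after the hard intervention that replaces the mechanism of node `l` by the
density `r`. -/
def intPDF (r : ℝ → ℝ) (l : Fin n) (z : Fin n → ℝ) : ℝ :=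
  r (z l) * ∏ i ∈ Finset.univ.erase l, M.mech i (z i) (fun j => z j)

/-- The observational law of the latent variables. -/
def law : Measure (Fin n → ℝ) :=
  volume.withDensity fun z => ENNReal.ofReal (M.pdf z)

/-- The law of the latent variables in the `m`-th environment of the first family. -/
def lawE (m : Fin n) : Measure (Fin n → ℝ) :=
  volume.withDensity fun z => ENNReal.ofReal (M.intPDF (M.q (M.target m)) (M.target m) z)

/-- The law of the latent variables in the `m`-th environment of the second family. -/
def lawE' (m : Fin n) : Measure (Fin n → ℝ) :=
  volume.withDensity fun z => ENNReal.ofReal (M.intPDF (M.q' (M.target m)) (M.target m) z)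

/-- The two hard interventional mechanisms of every node satisfy interventional discrepancy. -/
def Discrepancy : Prop :=
  ∀ i, InterventionalDiscrepancy (M.q i) (M.q' i)

/-- Additive noise: `Z_i = f_i (Z_{Pa i}) + N_i`, where the noise `N_i` has a density `ν` with full
support; that is, `p_i (u | w) = ν (u - f_i w)`. -/
def AdditiveNoise : Prop :=
  ∀ i, ∃ (f : (M.graph.pa i → ℝ) → ℝ) (ν : ℝ → ℝ),
    (∀ u, 0 < ν u) ∧ ∫⁻ u, ENNReal.ofReal (ν u) = 1 ∧ ∀ u w, M.mech i u w = ν (u - f w)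

/-- The observational latent density is twice differentiable. -/
def TwiceDifferentiable : Prop :=
  Differentiable ℝ M.pdf ∧ Differentiable ℝ (fderiv ℝ M.pdf)

/-- Adjacency-faithfulness: if `i` and `j` are adjacent, then `Z_i` and `Z_j` are dependent
conditionally on every subset of the remaining variables. -/
def AdjacencyFaithful : Prop :=
  ∀ i j, i ∈ M.graph.pa j →
    ∀ S : Set (Fin n), i ∉ S → j ∉ S → ¬ CoordCondIndep M.law i j S

end Model

/-! ### The data available to the learner -/

/-- What the learner observes: the image `𝒳 ⊆ ℝᵈ` of the transformation, and the laws of the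
observed variables in the two coupled families of interventional environments.  No observational
law is included, and neither are the intervention targets. -/
structure Data (n d : ℕ) where
  X : Set (Fin d → ℝ)
  E : Fin n → Measure (Fin d → ℝ)
  E' : Fin n → Measure (Fin d → ℝ)

/-- The interventional data generated by a model through `X = g(Z)`. -/
def Model.data {n d : ℕ} (M : Model n d) : Data n d where
  X := Set.range M.g
  E m := (M.lawE m).map M.g
  E' m := (M.lawE' m).map M.g

/-! ### Perfect recovery -/

/-- A `C¹` diffeomorphism of `ℝ`. -/
def IsDiffeoReal (f : ℝ → ℝ) : Prop :=
  ContDiff ℝ 1 f ∧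
    ∃ k : ℝ → ℝ, ContDiff ℝ 1 k ∧ Function.LeftInverse k f ∧ Function.RightInverse k f

/-- Perfect latent recovery by the estimator `h`: for some permutation `π` and diffeomorphisms
`φ_i` of `ℝ`, `h(g(z)) = P_π (φ_1(z_1), …, φ_n(z_n))` for all `z`. -/
def PerfectLatentRecovery {n d : ℕ} (M : Model n d) (h : (Fin d → ℝ) → (Fin n → ℝ)) : Prop :=
  ∃ (π : Equiv.Perm (Fin n)) (φ : Fin n → ℝ → ℝ), (∀ i, IsDiffeoReal (φ i)) ∧
    ∀ z i, h (M.g z) i = φ (π i) (z (π i))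

/-- Perfect DAG recovery: the estimated graph is isomorphic to the latent graph. -/
def PerfectDAGRecovery {n d : ℕ} (M : Model n d) (G : Digraph (Fin n)) : Prop :=
  ∃ π : Equiv.Perm (Fin n), ∀ i j, M.graph.toDigraph.Adj i j ↔ G.Adj (π i) (π j)

/-! ### The recovery algorithm -/

namespace Data

variable {n d : ℕ} (D : Data n d) (h : (Fin d → ℝ) → (Fin n → ℝ))

/-- Valid encoders: the `C¹` diffeomorphisms of the observation manifold onto `ℝⁿ`.  The map `k` is
the associated decoder. -/
def IsValidEncoder : Prop :=
  ContDiffOn ℝ 1 h D.X ∧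
    ∃ k : (Fin n → ℝ) → (Fin d → ℝ), ContDiff ℝ 1 k ∧ Set.range k = D.X ∧
      (∀ x ∈ D.X, k (h x) = x) ∧ ∀ z, h (k z) = z

/-- The law of the estimate `Ẑ = h(X)` in the `m`-th environment of the first family. -/
def latE (m : Fin n) : Measure (Fin n → ℝ) := (D.E m).map h

/-- The law of the estimate `Ẑ = h(X)` in the `m`-th environment of the second family. -/
def latE' (m : Fin n) : Measure (Fin n → ℝ) := (D.E' m).map h

/-- The score change matrix of an encoder: entry `(i, m)` is the expected absolute change of the
`i`-th coordinate of the score of `Ẑ` between the two environments number `m`. -/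
def scoreChangeMatrix : Matrix (Fin n) (Fin n) ℝ≥0∞ :=
  Matrix.of fun i m => scoreChange (D.latE h m) (D.latE' h m) i

/-- The number `‖·‖₀` of nonzero entries of the score change matrix. -/
def numScoreChanges : ℕ :=
  {e : Fin n × Fin n | D.scoreChangeMatrix h e.1 e.2 ≠ 0}.ncard

/-- `h` solves the problem of minimizing the number of nonzero entries of the score change matrix
over all valid encoders for which this matrix is diagonal. -/
def IsOptimalEncoder : Prop :=
  D.IsValidEncoder h ∧ (D.scoreChangeMatrix h).IsDiag ∧
    ∀ h', D.IsValidEncoder h' → (D.scoreChangeMatrix h').IsDiag →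
      D.numScoreChanges h ≤ D.numScoreChanges h'

/-- The coordinates in which the score of `Ẑ` changes across the two mismatched pairs of
environments with numbers `i` and `j`: an estimate of `Pa(i) ∪ Pa(j) ∪ {i, j}`. -/
def pairSet (i j : Fin n) : Set (Fin n) :=
  {k | scoreChange (D.latE h i) (D.latE' h j) k ≠ 0 ∨
    scoreChange (D.latE h j) (D.latE' h i) k ≠ 0}

/-- `ℬ_i`, the intersection of the estimated sets over all pairs containing `i`. -/
def interSet (i : Fin n) : Set (Fin n) :=
  {k | ∀ j, j ≠ i → k ∈ D.pairSet h i j}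

/-- The set of the nodes `i` for which `ℬ_i` has exactly one element. -/
def singletonSet : Set (Fin n) :=
  {i | (D.interSet h i).ncard = 1}

/-- Node `i` is declared a root if, for some pair `i, j` whose estimated set has two elements,
either `Ẑ_i` and `Ẑ_j` are dependent when `i` is intervened, or they are independent both when `i`
is intervened and when `j` is intervened. -/
def DeclaredRoot (i : Fin n) : Prop :=
  ∃ j, j ≠ i ∧ (D.pairSet h i j).ncard = 2 ∧
    (¬ CoordCondIndep (D.latE h i) i j ∅ ∨
      (CoordCondIndep (D.latE h i) i j ∅ ∧ CoordCondIndep (D.latE' h j) i j ∅))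

/-- The estimated graph.  An edge `k → j` needs `k ∈ ℬ_j \ {j}`.  This is the only condition if at
least two of the sets `ℬ_i` are singletons.  Otherwise `j` must also not be a declared root and, if
`k` is the only declared root, `Ẑ_k` and `Ẑ_j` must be dependent given the variables in
`ℬ_j \ {j, k}` when `k` is intervened. -/
def graphEstimate : Digraph (Fin n) where
  Adj k j := k ≠ j ∧ k ∈ D.interSet h j ∧
    (2 ≤ (D.singletonSet h).ncard ∨
      (¬ D.DeclaredRoot h j ∧
        ((∀ i, D.DeclaredRoot h i ↔ i = k) →
          ¬ CoordCondIndep (D.latE h k) k j (D.interSet h j \ {j, k}))))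

end Data

end

end CausalRep

namespace CausalRep

/-! ### Densities and scores under diffeomorphisms -/

/-! Latent recovery. In a difference of log-densities of `Ẑ` the Jacobian of the encoder cancels,
and between two coupled environments with target `ℓ` so do all mechanisms except `q_ℓ` and `q̃_ℓ`.
What remains is `log (q_ℓ / q̃_ℓ)` at the latent coordinate `ℓ`, written as a function of `ẑ`.
Discrepancy keeps this ratio from being constant on any interval, so its derivative in `ẑ_k`
vanishes identically only if the latent coordinate itself does not depend on `ẑ_k`
(`scoreChangeMatrix_eq_zero_iff`). A diagonal matrix thus makes every latent coordinate a function
of one coordinate of `ẑ` (`exists_eq_permMap`). The true inverse, with coordinates ordered by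
target, is feasible, and the objective is a natural number, so an optimum exists.

Graph recovery, with nodes numbered like the environments. Across a mismatched pair `i, j` the
log-density difference contains `log p_j - log p_i`. Under additive noise and faithfulness two
mechanisms never cancel at a parent of one of them, so the pair set is exactly `{i, j} ∪ Pa(i) ∪
Pa(j)` (`mem_pairSet_iff`). Hence `ℬ_j` contains `j` and its parents, and a spurious `k ∈ ℬ_j` must
be a parent of every node other than `j` and `k`. Then `k` lies in every `ℬ_i`, so at most `ℬ_k` is
a singleton; moreover, unless `j` is a root, `k` is the only root. These cases are separated by
counting singletons, by detecting roots, and by one conditional independence test with `k`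
intervened.

The tests are decided by two facts about laws that factorize along a DAG. A node is independent of
each non-descendant given variables that determine its factor (`MarkovFactors.coordCondIndep`).
Conversely, such an independence forces a continuous factor to ignore the variable tested
(`update_eq_of_coordCondIndep`). Faithfulness of the observational law enters only through the
consequence that each mechanism truly depends on each parent, a property that survives interventions
on other nodes. -/

theorem IsContinuousPDF.unique {n : ℕ} {μ : Measure (Fin n → ℝ)} {f g : (Fin n → ℝ) → ℝ}
    (hf : IsContinuousPDF μ f) (hg : IsContinuousPDF μ g) : f = g := by
  have h := hf.2.2.symm.trans hg.2.2
  rw [withDensity_eq_iff_of_sigmaFinite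
    hf.1.measurable.ennreal_ofReal.aemeasurable hg.1.measurable.ennreal_ofReal.aemeasurable] at h
  refine (Continuous.ae_eq_iff_eq (μ := volume) hf.1 hg.1).1 ?_
  filter_upwards [h] with z hz
  exact (ENNReal.ofReal_eq_ofReal_iff (hf.2.1 z) (hg.2.1 z)).1 hz

theorem IsContinuousPDF.contPDF_eq {n : ℕ} {μ : Measure (Fin n → ℝ)} {f : (Fin n → ℝ) → ℝ}
    (hf : IsContinuousPDF μ f) : contPDF μ = f := by
  have h : ∃ f, IsContinuousPDF μ f := ⟨f, hf⟩
  rw [contPDF, dif_pos h]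
  exact h.choose_spec.unique hf

/-- A `C¹` diffeomorphism `ψ` of `ℝⁿ` with inverse `χ`. -/
structure IsDiffeoPair {n : ℕ} (ψ χ : (Fin n → ℝ) → (Fin n → ℝ)) : Prop where
  contDiff : ContDiff ℝ 1 ψ
  contDiff_inv : ContDiff ℝ 1 χ
  left_inv : ∀ z, χ (ψ z) = z
  right_inv : ∀ y, ψ (χ y) = y

namespace IsDiffeoPair

variable {n : ℕ} {ψ χ : (Fin n → ℝ) → (Fin n → ℝ)}

theorem det_fderiv_inv_ne_zero (H : IsDiffeoPair ψ χ) (y : Fin n → ℝ) :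
    (fderiv ℝ χ y).det ≠ 0 := by
  have h1 : HasFDerivAt χ (fderiv ℝ χ y) y :=
    (H.contDiff_inv.differentiable one_ne_zero y).hasFDerivAt
  have h2 : HasFDerivAt ψ (fderiv ℝ ψ (χ y)) (χ y) :=
    (H.contDiff.differentiable one_ne_zero _).hasFDerivAt
  have h3 : HasFDerivAt (ψ ∘ χ) ((fderiv ℝ ψ (χ y)).comp (fderiv ℝ χ y)) y := h2.comp y h1
  have h4 : ψ ∘ χ = id := funext H.right_inv
  rw [h4] at h3
  have h5 := h3.unique (hasFDerivAt_id y)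
  intro h0
  have h6 : LinearMap.det (((fderiv ℝ ψ (χ y)).comp (fderiv ℝ χ y)).toLinearMap) = 1 := by
    rw [h5]; simp
  rw [ContinuousLinearMap.toLinearMap_comp, LinearMap.det_comp] at h6
  rw [ContinuousLinearMap.det] at h0
  rw [h0, mul_zero] at h6
  exact zero_ne_one h6

theorem isContinuousPDF_map (H : IsDiffeoPair ψ χ) {P : (Fin n → ℝ) → ℝ} (hP : Continuous P)
    (hP0 : ∀ z, 0 ≤ P z) :
    IsContinuousPDF ((volume.withDensity fun z => ENNReal.ofReal (P z)).map ψ)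
      (fun y => P (χ y) * |(fderiv ℝ χ y).det|) := by
  have hdet : Continuous fun y => (fderiv ℝ χ y).det :=
    ContinuousLinearMap.continuous_det.comp (H.contDiff_inv.continuous_fderiv one_ne_zero)
  refine ⟨(hP.comp H.contDiff_inv.continuous).mul hdet.abs,
    fun y => mul_nonneg (hP0 _) (abs_nonneg _), ?_⟩
  have hψ : Measurable ψ := H.contDiff.continuous.measurable
  ext A hA
  rw [Measure.map_apply hψ hA, withDensity_apply _ (hψ hA), withDensity_apply _ hA]
  have himg : ψ ⁻¹' A = χ '' A := by
    ext z
    constructor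
    · intro hz
      exact ⟨ψ z, hz, H.left_inv z⟩
    · rintro ⟨y, hy, rfl⟩
      simpa [H.right_inv] using hy
  rw [himg, lintegral_image_eq_lintegral_abs_det_fderiv_mul volume hA
    (fun y _ => ((H.contDiff_inv.differentiable one_ne_zero y).hasFDerivAt).hasFDerivWithinAt)
    (fun x _ y _ hxy => by rw [← H.right_inv x, hxy, H.right_inv])]
  refine lintegral_congr fun y => ?_
  rw [ENNReal.ofReal_mul (hP0 _), mul_comm]

end IsDiffeoPair

/-- Replaces a vanishing partial derivative by invariance under changing one coordinate, so that
later arguments need no derivatives. -/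
theorem fderiv_single_eq_zero_iff {n : ℕ} {F : (Fin n → ℝ) → ℝ} (hF : Differentiable ℝ F)
    (i : Fin n) :
    (∀ y, fderiv ℝ F y (Pi.single i 1) = 0) ↔ ∀ y t, F (Function.update y i t) = F y := by
  have key : ∀ y t, HasDerivAt (fun s => F (Function.update y i s))
      (fderiv ℝ F (Function.update y i t) (Pi.single i 1)) t := fun y t =>
    (hF (Function.update y i t)).hasFDerivAt.comp_hasDerivAt t (hasDerivAt_update y i t)
  constructor
  · intro h y t
    have := is_const_of_deriv_eq_zero (f := fun s => F (Function.update y i s))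
      (fun s => (key y s).differentiableAt) (fun s => by rw [(key y s).deriv, h]) t (y i)
    simpa using this
  · intro h y
    have h1 := key y (y i)
    simp only [h, Function.update_eq_self] at h1
    exact h1.unique (hasDerivAt_const _ _)

/-- Both densities carry the same Jacobian factor, which cancels in the log-ratio. The density is
positive, so a zero expectation means a derivative that vanishes Lebesgue-a.e., hence everywhere by
continuity. -/
theorem IsDiffeoPair.scoreChange_map_eq_zero_iff {n : ℕ} {ψ χ : (Fin n → ℝ) → (Fin n → ℝ)}
    (H : IsDiffeoPair ψ χ) {P Q : (Fin n → ℝ) → ℝ} (hP : ContDiff ℝ 1 P) (hQ : ContDiff ℝ 1 Q)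
    (hP0 : ∀ z, 0 < P z) (hQ0 : ∀ z, 0 < Q z) (i : Fin n) :
    scoreChange ((volume.withDensity fun z => ENNReal.ofReal (P z)).map ψ)
      ((volume.withDensity fun z => ENNReal.ofReal (Q z)).map ψ) i = 0 ↔
    ∀ y t, Real.log (P (χ (Function.update y i t))) - Real.log (Q (χ (Function.update y i t))) =
      Real.log (P (χ y)) - Real.log (Q (χ y)) := by
  have hPpdf := H.isContinuousPDF_map hP.continuous fun z => (hP0 z).le
  have hQpdf := H.isContinuousPDF_map hQ.continuous fun z => (hQ0 z).le
  set F : (Fin n → ℝ) → ℝ := fun y => Real.log (P (χ y)) - Real.log (Q (χ y)) with hFdef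
  have hFC : ContDiff ℝ 1 F :=
    ((hP.comp H.contDiff_inv).log fun y => (hP0 _).ne').sub
      ((hQ.comp H.contDiff_inv).log fun y => (hQ0 _).ne')
  have hscore : ∀ y, scoreDiff ((volume.withDensity fun z => ENNReal.ofReal (P z)).map ψ)
      ((volume.withDensity fun z => ENNReal.ofReal (Q z)).map ψ) i y =
      fderiv ℝ F y (Pi.single i 1) := by
    intro y
    rw [scoreDiff, hPpdf.contPDF_eq, hQpdf.contPDF_eq]
    congr 2
    funext y
    have hd := H.det_fderiv_inv_ne_zero y
    rw [Real.log_mul (hP0 _).ne' (abs_ne_zero.2 hd), Real.log_mul (hQ0 _).ne' (abs_ne_zero.2 hd)]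
    simp only [hFdef]
    ring
  have hcont : Continuous fun y => fderiv ℝ F y (Pi.single i 1) :=
    (hFC.continuous_fderiv one_ne_zero).clm_apply continuous_const
  rw [← fderiv_single_eq_zero_iff (hFC.differentiable one_ne_zero) i, scoreChange]
  simp only [hscore]
  rw [lintegral_eq_zero_iff hcont.enorm.measurable, hPpdf.2.2]
  constructor
  · intro h
    have h2 : (fun y => fderiv ℝ F y (Pi.single i 1)) =ᵐ[volume] fun _ => (0 : ℝ) := by
      rw [Filter.EventuallyEq, ae_withDensity_iff
        hPpdf.1.measurable.ennreal_ofReal] at h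
      filter_upwards [h] with y hy
      have : ENNReal.ofReal (P (χ y) * |(fderiv ℝ χ y).det|) ≠ 0 := by
        rw [Ne, ENNReal.ofReal_eq_zero, not_le]
        exact mul_pos (hP0 _) (abs_pos.2 (H.det_fderiv_inv_ne_zero y))
      simpa using hy this
    exact fun y => congrFun ((hcont.ae_eq_iff_eq volume continuous_const).1 h2) y
  · intro h
    exact Filter.Eventually.of_forall fun y => by simp [h y]

/-! ### Conditional independence of coordinates -/

section CoordCondIndep

variable {n : ℕ}

/-- The restriction of a vector to the coordinates in `S`. -/
def coords (S : Set (Fin n)) (z : Fin n → ℝ) : S → ℝ := fun l => z l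

theorem measurable_coords (S : Set (Fin n)) : Measurable (coords S) :=
  measurable_pi_lambda _ fun l => measurable_pi_apply (l : Fin n)

/-- The probability of `Z_j ∈ A` given `Z_k` and `Z_S` is a function of `Z_S`. -/
theorem coordCondIndep_iff {μ : Measure (Fin n → ℝ)} [hμ : IsFiniteMeasure μ] {j k : Fin n}
    {S : Set (Fin n)} :
    CoordCondIndep μ k j S ↔
      ∀ A : Set ℝ, MeasurableSet A → ∃ G : (S → ℝ) → ℝ≥0∞, Measurable G ∧
        ∀ (B : Set ℝ) (C : Set (S → ℝ)), MeasurableSet B → MeasurableSet C →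
          μ ((coords S ⁻¹' C ∩ (fun z => z k) ⁻¹' B) ∩ (fun z => z j) ⁻¹' A) =
            ∫⁻ z in coords S ⁻¹' C ∩ (fun z => z k) ⁻¹' B, G (coords S z) ∂μ := by
  have hj : Measurable fun z : Fin n → ℝ => z j := measurable_pi_apply j
  have hk : Measurable fun z : Fin n → ℝ => z k := measurable_pi_apply k
  have hS := measurable_coords S
  constructor
  · rintro ⟨_, h⟩ A hA
    have h1 := (condIndepFun_iff_condDistrib_prod_ae_eq_prodMkRight (μ := μ) hj hk hS).1 h
    refine ⟨fun s => condDistrib (fun z => z j) (coords S) μ s A,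
      Kernel.measurable_coe _ hA, fun B C hB hC => ?_⟩
    have h2 := setLIntegral_preimage_condDistrib (μ := μ) (hS.prodMk hk) hj.aemeasurable hA
      (hC.prod hB)
    rw [Set.mk_preimage_prod] at h2
    rw [← h2]
    refine lintegral_congr_ae (ae_restrict_of_ae ?_)
    filter_upwards [ae_of_ae_map (hS.prodMk hk).aemeasurable h1] with z hz
    rw [hz]
    rfl
  · intro h
    refine ⟨hμ, ?_⟩
    suffices h' : CondIndepFun (MeasurableSpace.comap (coords S) inferInstance) hS.comap_le
        (fun z : Fin n → ℝ => z k) (fun z => z j) μ from h'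
    rw [condIndepFun_iff_map_prod_eq_prod_condDistrib_prod_condDistrib hk hj hS]
    rw [Measure.ext_prod₃_iff]
    intro C B A hC hB hA
    obtain ⟨G, hG, hGA⟩ := h A hA
    -- The case `B = univ` of the hypothesis shows that `G` is a version of the conditional
    -- probability given `Z_S` alone.
    have hGae : ∀ᵐ s ∂(μ.map (coords S)),
        condDistrib (fun z => z j) (coords S) μ s A = G s := by
      refine ae_eq_of_forall_setLIntegral_eq_of_sigmaFinite (Kernel.measurable_coe _ hA) hG ?_
      intro C hC _
      rw [setLIntegral_map hC (Kernel.measurable_coe _ hA) hS, setLIntegral_map hC hG hS,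
        setLIntegral_preimage_condDistrib hS hj.aemeasurable hA hC]
      have := hGA Set.univ C MeasurableSet.univ hC
      simpa using this
    rw [Measure.map_apply (by fun_prop) (hC.prod (hB.prod hA)),
      Measure.bind_apply (hC.prod (hB.prod hA)) (by fun_prop)]
    have e1 : (fun ω : Fin n → ℝ => (coords S ω, ω k, ω j)) ⁻¹' (C ×ˢ B ×ˢ A) =
        (coords S ⁻¹' C ∩ (fun z => z k) ⁻¹' B) ∩ (fun z => z j) ⁻¹' A := by
      ext z; simp [and_assoc]
    rw [e1, hGA B C hB hC]
    have hG1 : Measurable fun x : (S → ℝ) × ℝ => G x.1 := hG.comp measurable_fst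
    have e2 : ∫⁻ z in coords S ⁻¹' C ∩ (fun z => z k) ⁻¹' B, G (coords S z) ∂μ =
        ∫⁻ x, (C ×ˢ B).indicator (fun x => G x.1) x ∂(μ.map fun z => (coords S z, z k)) := by
      rw [lintegral_indicator (hC.prod hB),
        setLIntegral_map (hC.prod hB) hG1 (hS.prodMk hk)]
      rfl
    rw [e2, ← compProd_map_condDistrib hk.aemeasurable,
      Measure.lintegral_compProd (hG1.indicator (hC.prod hB))]
    refine lintegral_congr_ae ?_
    filter_upwards [hGae] with s hs
    rw [Kernel.prod_apply_prod, Kernel.prod_apply_prod, Kernel.id_apply,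
      Measure.dirac_apply' _ hC, hs]
    have e3 : (fun b => (C ×ˢ B).indicator (fun x : (S → ℝ) × ℝ => G x.1) (s, b)) =
        fun b => C.indicator 1 s * G s * B.indicator 1 b := by
      funext b
      by_cases h1 : s ∈ C <;> by_cases h2 : b ∈ B <;> simp [h1, h2]
    rw [e3, lintegral_const_mul _ (measurable_one.indicator hB), lintegral_indicator_one hB]
    ring

theorem CoordCondIndep.symm {μ : Measure (Fin n → ℝ)} {j k : Fin n} {S : Set (Fin n)}
    (h : CoordCondIndep μ j k S) : CoordCondIndep μ k j S := by
  obtain ⟨hμ, h⟩ := h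
  exact ⟨hμ, CondIndepFun.symm h⟩

/-- The map that moves coordinate `I m` to coordinate `m` and transforms it by `φ m`. -/
def permMap (I : Equiv.Perm (Fin n)) (φ : Fin n → ℝ → ℝ) (z : Fin n → ℝ) : Fin n → ℝ :=
  fun m => φ m (z (I m))

theorem measurable_permMap (I : Equiv.Perm (Fin n)) {φ : Fin n → ℝ → ℝ}
    (hφ : ∀ m, Measurable (φ m)) : Measurable (permMap I φ) :=
  measurable_pi_lambda _ fun m => (hφ m).comp (measurable_pi_apply _)

/-- The coordinates in `S` after the map and those in `I '' S` before it are measurable functions of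
each other, so conditioning on either is the same. -/
theorem CoordCondIndep.map_permMap {μ : Measure (Fin n → ℝ)} {I : Equiv.Perm (Fin n)}
    {φ c : Fin n → ℝ → ℝ} (hφ : ∀ m, Measurable (φ m)) (hc : ∀ m, Measurable (c m))
    (hcφ : ∀ m u, c m (φ m u) = u) {k j : Fin n} {S : Set (Fin n)}
    (h : CoordCondIndep μ (I k) (I j) (I '' S)) :
    CoordCondIndep (μ.map (permMap I φ)) k j S := by
  have hμ : IsFiniteMeasure μ := h.1
  have hψ := measurable_permMap I hφ
  have hk : Measurable fun z : Fin n → ℝ => z k := measurable_pi_apply k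
  have hj : Measurable fun z : Fin n → ℝ => z j := measurable_pi_apply j
  rw [coordCondIndep_iff] at h ⊢
  intro A hA
  obtain ⟨G, hG, hGA⟩ := h (φ j ⁻¹' A) (hφ j hA)
  have hI : ∀ l : (I '' S : Set (Fin n)), I.symm l ∈ S := by
    rintro ⟨_, m, hm, rfl⟩
    simpa using hm
  let a : (S → ℝ) → ((I '' S : Set (Fin n)) → ℝ) :=
    fun s l => c (I.symm l) (s ⟨I.symm l, hI l⟩)
  let b : ((I '' S : Set (Fin n)) → ℝ) → (S → ℝ) :=
    fun s l => φ l (s ⟨I l, Set.mem_image_of_mem _ l.2⟩)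
  have ha : Measurable a :=
    measurable_pi_lambda _ fun l => (hc _).comp (measurable_pi_apply _)
  have hb : Measurable b :=
    measurable_pi_lambda _ fun l => (hφ _).comp (measurable_pi_apply _)
  have hba : ∀ z, coords S (permMap I φ z) = b (coords (I '' S) z) := fun z => rfl
  have hab : ∀ z, a (coords S (permMap I φ z)) = coords (I '' S) z := by
    intro z
    funext l
    simp [a, coords, permMap, hcφ]
  refine ⟨G ∘ a, hG.comp ha, fun B C hB hC => ?_⟩
  have hCB := (measurable_coords S hC).inter (hk hB)
  have hpre : permMap I φ ⁻¹' (coords S ⁻¹' C ∩ (fun z => z k) ⁻¹' B) =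
      coords (I '' S) ⁻¹' (b ⁻¹' C) ∩ (fun z => z (I k)) ⁻¹' (φ k ⁻¹' B) := by
    ext z
    simp only [Set.mem_preimage, Set.mem_inter_iff, hba]
    rfl
  have hGS : Measurable fun z => (G ∘ a) (coords S z) := (hG.comp ha).comp (measurable_coords S)
  rw [Measure.map_apply hψ (hCB.inter (hj hA)), Set.preimage_inter, hpre,
    setLIntegral_map hCB hGS hψ, hpre]
  simp only [Function.comp_apply, hab]
  exact hGA _ _ (hφ k hB) (hb hC)

theorem coordCondIndep_map_permMap_iff {μ : Measure (Fin n → ℝ)} {I : Equiv.Perm (Fin n)}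
    {φ c : Fin n → ℝ → ℝ} (hφ : ∀ m, Measurable (φ m)) (hc : ∀ m, Measurable (c m))
    (hcφ : ∀ m u, c m (φ m u) = u) (hφc : ∀ m u, φ m (c m u) = u) {k j : Fin n}
    {S : Set (Fin n)} :
    CoordCondIndep (μ.map (permMap I φ)) k j S ↔ CoordCondIndep μ (I k) (I j) (I '' S) := by
  refine ⟨fun h => ?_, CoordCondIndep.map_permMap hφ hc hcφ⟩
  have h1 : CoordCondIndep ((μ.map (permMap I φ)).map
      (permMap I.symm fun l => c (I.symm l))) (I k) (I j) (I '' S) := by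
    refine CoordCondIndep.map_permMap (c := fun l => φ (I.symm l)) (fun _ => hc _)
      (fun _ => hφ _) (fun _ => hφc _) ?_
    rw [I.symm_apply_apply, I.symm_apply_apply, I.symm_image_image]
    exact h
  rw [Measure.map_map (measurable_permMap _ fun _ => hc _) (measurable_permMap _ hφ)] at h1
  have h2 : (permMap I.symm fun l => c (I.symm l)) ∘ permMap I φ = id := by
    funext z l
    simp [permMap, hcφ]
  rwa [h2, Measure.map_id] at h1

end CoordCondIndep

/-! ### Densities that factorize along a directed acyclic graph -/

theorem lmarginal_const_mul {n : ℕ} (s : Finset (Fin n)) {g h : (Fin n → ℝ) → ℝ≥0∞}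
    (hg : DependsOn g (sᶜ : Set (Fin n))) (hh : Measurable h) (z : Fin n → ℝ) :
    (∫⋯∫⁻_s, (fun z => g z * h z) ∂fun _ => (volume : Measure ℝ)) z =
      g z * (∫⋯∫⁻_s, h ∂fun _ => (volume : Measure ℝ)) z := by
  have hm : Measurable fun y : s → ℝ => h (Function.updateFinset z s y) :=
    hh.comp measurable_updateFinset
  rw [lmarginal, lmarginal, ← lintegral_const_mul _ hm]
  refine lintegral_congr fun y => ?_
  congr 1
  refine hg fun i hi => ?_
  rw [Function.updateFinset_def]
  exact dif_neg hi

theorem dependsOn_mul {ι α M : Type*} [Mul M] {f g : (ι → α) → M} {s : Set ι}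
    (hf : DependsOn f s) (hg : DependsOn g s) : DependsOn (fun z => f z * g z) s :=
  fun x y h => by simp only [hf h, hg h]

theorem dependsOn_prod {ι κ α M : Type*} [CommMonoid M] {f : κ → (ι → α) → M} {s : Set ι}
    {T : Finset κ} (hf : ∀ k ∈ T, DependsOn (f k) s) : DependsOn (fun z => ∏ k ∈ T, f k z) s :=
  fun _ _ h => Finset.prod_congr rfl fun k hk => hf k hk h

namespace DAG

variable {n : ℕ} (G : DAG n)

/-- `G.Reach j l` if there is a directed path, possibly of length zero, from `j` to `l`. -/
def Reach (j l : Fin n) : Prop := Relation.ReflTransGen (fun a b => a ∈ G.pa b) j l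

theorem notMem_pa_self (i : Fin n) : i ∉ G.pa i :=
  fun h => G.acyclic i (Relation.TransGen.single h)

theorem not_reach_of_mem_pa {j l : Fin n} (h : l ∈ G.pa j) : ¬ G.Reach j l :=
  fun h' => G.acyclic l (Relation.TransGen.head' h h')

theorem not_mem_pa_of_mem_pa {j l : Fin n} (h : l ∈ G.pa j) : j ∉ G.pa l :=
  fun h' => G.acyclic l ((Relation.TransGen.single h).tail h')

theorem wellFounded_transGen :
    WellFounded (Relation.TransGen fun a b : Fin n => a ∈ G.pa b) := by
  have : IsTrans (Fin n) (Relation.TransGen fun a b : Fin n => a ∈ G.pa b) :=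
    ⟨fun _ _ _ => Relation.TransGen.trans⟩
  have : Std.Irrefl (Relation.TransGen fun a b : Fin n => a ∈ G.pa b) := ⟨G.acyclic⟩
  exact Finite.wellFounded_of_trans_of_irrefl _

/-- Every nonempty set of nodes has a source. -/
theorem exists_source {T : Set (Fin n)} (hT : T.Nonempty) : ∃ j ∈ T, ∀ i ∈ T, i ∉ G.pa j := by
  obtain ⟨j, hj, h⟩ := G.wellFounded_transGen.has_min T hT
  exact ⟨j, hj, fun i hi hij => h i hi (Relation.TransGen.single hij)⟩

/-- Every nonempty set of nodes has a sink. -/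
theorem exists_sink {T : Set (Fin n)} (hT : T.Nonempty) : ∃ j ∈ T, ∀ i ∈ T, j ∉ G.pa i := by
  have : IsTrans (Fin n) (Function.swap (Relation.TransGen fun a b : Fin n => a ∈ G.pa b)) :=
    ⟨fun _ _ _ h1 h2 => Relation.TransGen.trans h2 h1⟩
  have : Std.Irrefl (Function.swap (Relation.TransGen fun a b : Fin n => a ∈ G.pa b)) :=
    ⟨G.acyclic⟩
  obtain ⟨j, hj, h⟩ := (Finite.wellFounded_of_trans_of_irrefl
    (Function.swap (Relation.TransGen fun a b : Fin n => a ∈ G.pa b))).has_min T hT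
  exact ⟨j, hj, fun i hi hij => h i hi (Relation.TransGen.single hij)⟩

end DAG

/-- A family of positive continuous conditional densities of the nodes given their parents. -/
structure MarkovFactors {n : ℕ} (G : DAG n) (f : Fin n → (Fin n → ℝ) → ℝ) : Prop where
  continuous : ∀ i, Continuous (f i)
  pos : ∀ i z, 0 < f i z
  dependsOn : ∀ i, DependsOn (f i) (insert i (G.pa i : Set (Fin n)))
  lintegral_update : ∀ i z, ∫⁻ u, ENNReal.ofReal (f i (Function.update z i u)) = 1

/-- The law whose density is the product of the factors. -/
noncomputable def factorLaw {n : ℕ} (f : Fin n → (Fin n → ℝ) → ℝ) : Measure (Fin n → ℝ) :=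
  volume.withDensity fun z => ENNReal.ofReal (∏ i, f i z)

namespace MarkovFactors

variable {n : ℕ} {G : DAG n} {f : Fin n → (Fin n → ℝ) → ℝ}

theorem measurable_ofReal (hf : MarkovFactors G f) (i : Fin n) :
    Measurable fun z => ENNReal.ofReal (f i z) :=
  (hf.continuous i).measurable.ennreal_ofReal

theorem measurable_prod (hf : MarkovFactors G f) (T : Finset (Fin n)) :
    Measurable fun z => ∏ i ∈ T, ENNReal.ofReal (f i z) :=
  Finset.measurable_prod _ fun i _ => hf.measurable_ofReal i

theorem dependsOn_ofReal (hf : MarkovFactors G f) (i : Fin n) :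
    DependsOn (fun z => ENNReal.ofReal (f i z)) (insert i (G.pa i : Set (Fin n))) :=
  fun x y h => by simp only [hf.dependsOn i h]

theorem measurable_setLIntegral_update (hf : MarkovFactors G f) (j : Fin n) (A : Set ℝ) :
    Measurable fun z : Fin n → ℝ => ∫⁻ u in A, ENNReal.ofReal (f j (Function.update z j u)) := by
  refine Measurable.lintegral_prod_right'
    (f := fun p : (Fin n → ℝ) × ℝ => ENNReal.ofReal (f j (Function.update p.1 j p.2))) ?_
  exact ((hf.continuous j).comp (continuous_fst.update j continuous_snd)).measurable.ennreal_ofReal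

/-- A sink of `T` occurs in no other factor of `T`, so it can be integrated out first, and its own
factor contributes `1`. -/
theorem lmarginal_prod (hf : MarkovFactors G f) (T : Finset (Fin n)) (z : Fin n → ℝ) :
    (∫⋯∫⁻_T, (fun z => ∏ i ∈ T, ENNReal.ofReal (f i z)) ∂fun _ => (volume : Measure ℝ)) z = 1 := by
  induction T using Finset.strongInduction generalizing z with
  | H T ih =>
    rcases T.eq_empty_or_nonempty with rfl | hT
    · simp
    · obtain ⟨j, hj, hsink⟩ := G.exists_sink (T := (T : Set (Fin n))) hT
      have hj' : j ∈ T := hj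
      rw [lmarginal_erase' _ (hf.measurable_prod T) hj', ← ih _ (Finset.erase_ssubset hj') z]
      congr 1
      funext x
      have h1 : ∀ u, ∏ i ∈ T, ENNReal.ofReal (f i (Function.update x j u)) =
          (∏ i ∈ T.erase j, ENNReal.ofReal (f i x)) *
            ENNReal.ofReal (f j (Function.update x j u)) := by
        intro u
        rw [← Finset.prod_erase_mul _ _ hj']
        congr 1
        refine Finset.prod_congr rfl fun i hi => ?_
        rw [hf.dependsOn i (x := Function.update x j u) (y := x)]
        intro l hl
        refine Function.update_of_ne ?_ _ _
        rintro rfl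
        rcases hl with rfl | hl
        · exact Finset.ne_of_mem_erase hi rfl
        · exact hsink i (Finset.mem_of_mem_erase hi) hl
      have hm : Measurable fun u => ENNReal.ofReal (f j (Function.update x j u)) :=
        (hf.measurable_ofReal j).comp (measurable_update x)
      simp only [h1]
      rw [lintegral_const_mul _ hm,
        hf.lintegral_update, mul_one]

theorem lmarginal_indicator_prod (hf : MarkovFactors G f) {T : Finset (Fin n)} {j : Fin n}
    {S : Set (Fin n)} (hfS : DependsOn (f j) (insert j S)) (hj : j ∈ T) (hS : ∀ l ∈ S, l ∉ T)
    {A : Set ℝ} (hA : MeasurableSet A) (z : Fin n → ℝ) :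
    (∫⋯∫⁻_T, (fun z => A.indicator 1 (z j) * ∏ i ∈ T, ENNReal.ofReal (f i z))
      ∂fun _ => (volume : Measure ℝ)) z =
      ∫⁻ u in A, ENNReal.ofReal (f j (Function.update z j u)) := by
  have hm : Measurable fun z : Fin n → ℝ => A.indicator (1 : ℝ → ℝ≥0∞) (z j) :=
    (measurable_one.indicator hA).comp (measurable_pi_apply j)
  have hm' : Measurable fun z : Fin n → ℝ => A.indicator (1 : ℝ → ℝ≥0∞) (z j) *
      ∏ i ∈ T, ENNReal.ofReal (f i z) := hm.mul (hf.measurable_prod T)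
  rw [lmarginal_erase _ hm' hj, ← lintegral_indicator hA]
  refine lintegral_congr fun u => ?_
  have h1 : (fun z : Fin n → ℝ => A.indicator (1 : ℝ → ℝ≥0∞) (z j) *
      ∏ i ∈ T, ENNReal.ofReal (f i z)) =
      fun z => (A.indicator 1 (z j) * ENNReal.ofReal (f j z)) *
        ∏ i ∈ T.erase j, ENNReal.ofReal (f i z) := by
    funext z
    rw [← Finset.mul_prod_erase _ _ hj, mul_assoc]
  rw [h1, lmarginal_const_mul, hf.lmarginal_prod]
  · by_cases hu : u ∈ A <;> simp [hu]
  · refine dependsOn_mul (fun x y h => ?_) (fun x y h => ?_)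
    · rw [h j (by simp)]
    · rw [hfS (x := x) (y := y)]
      rintro l (rfl | hl)
      · exact h _ (by simp)
      · exact h _ (by simp [hS l hl])
  · exact hf.measurable_prod _

/-- Given the non-descendants, the node `j` is distributed according to its own factor. -/
theorem lintegral_indicator_mul (hf : MarkovFactors G f) {j : Fin n} {S : Set (Fin n)}
    (hfS : DependsOn (f j) (insert j S)) (hS : ∀ l ∈ S, ¬ G.Reach j l)
    {A : Set ℝ} (hA : MeasurableSet A) {ψ : (Fin n → ℝ) → ℝ≥0∞} (hψ : Measurable ψ)
    (hψd : DependsOn ψ {l | ¬ G.Reach j l}) :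
    ∫⁻ z, A.indicator 1 (z j) * ψ z ∂factorLaw f =
      ∫⁻ z, (∫⁻ u in A, ENNReal.ofReal (f j (Function.update z j u))) * ψ z ∂factorLaw f := by
  classical
  have hm : Measurable fun z : Fin n → ℝ => A.indicator (1 : ℝ → ℝ≥0∞) (z j) :=
    (measurable_one.indicator hA).comp (measurable_pi_apply j)
  have hK := hf.measurable_setLIntegral_update j A
  have hprod : ∀ z, ENNReal.ofReal (∏ i, f i z) = ∏ i, ENNReal.ofReal (f i z) := fun z =>
    ENNReal.ofReal_prod_of_nonneg fun i _ => (hf.pos i z).le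
  have hd := hf.measurable_prod Finset.univ
  simp only [factorLaw, hprod]
  have hm1 : Measurable fun z : Fin n → ℝ => A.indicator (1 : ℝ → ℝ≥0∞) (z j) * ψ z :=
    hm.mul hψ
  have hK1 : Measurable fun z : Fin n → ℝ =>
      (∫⁻ u in A, ENNReal.ofReal (f j (Function.update z j u))) * ψ z := hK.mul hψ
  rw [lintegral_withDensity_eq_lintegral_mul _ hd hm1,
    lintegral_withDensity_eq_lintegral_mul _ hd hK1]
  -- `T` consists of `j` and its descendants. Its complement is closed under parents, so the factors
  -- outside `T` involve no variable of `T` and act as constants when `T` is integrated out.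
  set T : Finset (Fin n) := Finset.univ.filter fun l => G.Reach j l with hTdef
  have hjT : j ∈ T := Finset.mem_filter.2 ⟨Finset.mem_univ _, Relation.ReflTransGen.refl⟩
  have hST : ∀ l ∈ S, l ∉ T := fun l hl => by simpa [hTdef] using hS l hl
  refine lintegral_eq_of_lmarginal_eq (μ := fun _ => (volume : Measure ℝ)) T
    (hd.mul hm1) (hd.mul hK1) ?_
  have hψT : DependsOn ψ (Tᶜ : Set (Fin n)) := by
    refine hψd.mono fun l hl => ?_
    simpa [hTdef] using hl
  have hrest : DependsOn (fun z => ψ z * ∏ i ∈ Tᶜ, ENNReal.ofReal (f i z))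
      (Tᶜ : Set (Fin n)) := by
    refine dependsOn_mul hψT (dependsOn_prod fun i hi => (hf.dependsOn_ofReal i).mono ?_)
    have hi' : ¬ G.Reach j i := by simpa [hTdef] using hi
    rintro l (rfl | hl)
    · simpa [hTdef] using hi'
    · have : ¬ G.Reach j l := fun h => hi' (h.tail hl)
      simpa [hTdef] using this
  have hKT : DependsOn (fun z : Fin n → ℝ =>
      ∫⁻ u in A, ENNReal.ofReal (f j (Function.update z j u))) (Tᶜ : Set (Fin n)) := by
    intro x y h
    refine lintegral_congr fun u => ?_
    rw [hfS (x := Function.update x j u) (y := Function.update y j u)]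
    intro l hl
    by_cases hlj : l = j
    · subst hlj; simp
    · rw [Function.update_of_ne hlj, Function.update_of_ne hlj]
      exact h l (by simpa using hST l (hl.resolve_left hlj))
  have split : ∀ z, ∏ i, ENNReal.ofReal (f i z) =
      (∏ i ∈ Tᶜ, ENNReal.ofReal (f i z)) * ∏ i ∈ T, ENNReal.ofReal (f i z) := fun z => by
    rw [mul_comm, Finset.prod_mul_prod_compl]
  have e1 : ((fun z => ∏ i, ENNReal.ofReal (f i z)) *
      (fun z : Fin n → ℝ => A.indicator (1 : ℝ → ℝ≥0∞) (z j) * ψ z)) =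
      fun z => (ψ z * ∏ i ∈ Tᶜ, ENNReal.ofReal (f i z)) *
        (A.indicator 1 (z j) * ∏ i ∈ T, ENNReal.ofReal (f i z)) := by
    funext z
    simp only [Pi.mul_apply, split]
    ring
  have e2 : ((fun z => ∏ i, ENNReal.ofReal (f i z)) *
      (fun z : Fin n → ℝ =>
        (∫⁻ u in A, ENNReal.ofReal (f j (Function.update z j u))) * ψ z)) =
      fun z => ((∫⁻ u in A, ENNReal.ofReal (f j (Function.update z j u))) *
        (ψ z * ∏ i ∈ Tᶜ, ENNReal.ofReal (f i z))) *
        ∏ i ∈ T, ENNReal.ofReal (f i z) := by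
    funext z
    simp only [Pi.mul_apply, split]
    ring
  have hm2 : Measurable fun z : Fin n → ℝ => A.indicator (1 : ℝ → ℝ≥0∞) (z j) *
      ∏ i ∈ T, ENNReal.ofReal (f i z) := hm.mul (hf.measurable_prod T)
  rw [e1, e2]
  funext z
  rw [lmarginal_const_mul T hrest hm2,
    lmarginal_const_mul T (dependsOn_mul hKT hrest) (hf.measurable_prod T),
    hf.lmarginal_indicator_prod hfS hjT hST hA, hf.lmarginal_prod, mul_one, mul_comm]

theorem isProbabilityMeasure (hf : MarkovFactors G f) : IsProbabilityMeasure (factorLaw f) := by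
  constructor
  rw [factorLaw, withDensity_apply _ MeasurableSet.univ, Measure.restrict_univ, volume_pi,
    lintegral_eq_lmarginal_univ (0 : Fin n → ℝ), ← hf.lmarginal_prod Finset.univ 0]
  congr 1
  funext z
  exact ENNReal.ofReal_prod_of_nonneg fun i _ => (hf.pos i z).le

end MarkovFactors

/-! ### The local Markov property and its converse. -/

namespace MarkovFactors

variable {n : ℕ} {G : DAG n} {f : Fin n → (Fin n → ℝ) → ℝ}

open Classical in
/-- The vector with the given coordinates in `S` and zeros elsewhere. -/
noncomputable def extendZero (S : Set (Fin n)) (s : S → ℝ) (l : Fin n) : ℝ :=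
  if h : l ∈ S then s ⟨l, h⟩ else 0

theorem measurable_extendZero (S : Set (Fin n)) : Measurable (extendZero S) := by
  refine measurable_pi_lambda _ fun l => ?_
  by_cases h : l ∈ S
  · simpa [extendZero, h] using measurable_pi_apply _
  · simp [extendZero, h]

theorem extendZero_coords {S : Set (Fin n)} {l : Fin n} (h : l ∈ S) (z : Fin n → ℝ) :
    extendZero S (coords S z) l = z l := by
  simp [extendZero, coords, h]

theorem update_congr {j : Fin n} {S : Set (Fin n)} (hfS : DependsOn (f j) (insert j S))
    {z w : Fin n → ℝ} (h : ∀ l ∈ S, z l = w l) (u : ℝ) :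
    f j (Function.update z j u) = f j (Function.update w j u) := by
  refine hfS fun l hl => ?_
  by_cases hlj : l = j
  · subst hlj; simp
  · rw [Function.update_of_ne hlj, Function.update_of_ne hlj]
    exact h l (hl.resolve_left hlj)

theorem setLIntegral_eq_measure (hf : MarkovFactors G f) {j : Fin n} {S S' : Set (Fin n)}
    {k : Fin n} (hfS : DependsOn (f j) (insert j S)) (hS : ∀ l ∈ S, ¬ G.Reach j l)
    (hS' : ∀ l ∈ S', ¬ G.Reach j l) (hk : ¬ G.Reach j k)
    {A B : Set ℝ} {C : Set (S' → ℝ)}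
    (hA : MeasurableSet A) (hB : MeasurableSet B) (hC : MeasurableSet C) :
    ∫⁻ z in coords S' ⁻¹' C ∩ (fun z => z k) ⁻¹' B,
      (∫⁻ u in A, ENNReal.ofReal (f j (Function.update z j u))) ∂factorLaw f =
    factorLaw f ((coords S' ⁻¹' C ∩ (fun z => z k) ⁻¹' B) ∩ (fun z => z j) ⁻¹' A) := by
  set E : Set (Fin n → ℝ) := coords S' ⁻¹' C ∩ (fun z => z k) ⁻¹' B with hE
  have hEm : MeasurableSet E :=
    (measurable_coords S' hC).inter (measurable_pi_apply k hB)
  have hEd : DependsOn (E.indicator (1 : (Fin n → ℝ) → ℝ≥0∞)) {l | ¬ G.Reach j l} := by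
    intro x y h
    have h1 : coords S' x = coords S' y := funext fun l => h _ (hS' l l.2)
    have h2 : x k = y k := h _ hk
    have h3 : x ∈ E ↔ y ∈ E := by simp [hE, h1, h2]
    by_cases hx : x ∈ E
    · simp [hx, h3.1 hx]
    · simp [hx, mt h3.2 hx]
  have hAm : MeasurableSet ((fun z : Fin n → ℝ => z j) ⁻¹' A) := measurable_pi_apply j hA
  have h := hf.lintegral_indicator_mul hfS hS hA (measurable_one.indicator hEm) hEd
  rw [← lintegral_indicator_one (hEm.inter hAm), ← lintegral_indicator hEm]
  refine Eq.trans ?_ (h.symm.trans ?_)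
  · refine lintegral_congr fun z => ?_
    by_cases hz : z ∈ E <;> simp [hz]
  · refine lintegral_congr fun z => ?_
    by_cases hz : z ∈ E <;> by_cases hz' : z j ∈ A <;> simp [hz, hz']

/-- Local Markov property: given variables that determine its factor, a node is conditionally
independent of each non-descendant. -/
theorem coordCondIndep (hf : MarkovFactors G f) {j k : Fin n} {S : Set (Fin n)}
    (hfS : DependsOn (f j) (insert j S)) (hS : ∀ l ∈ S, ¬ G.Reach j l) (hk : ¬ G.Reach j k) :
    CoordCondIndep (factorLaw f) k j S := by
  have := hf.isProbabilityMeasure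
  rw [coordCondIndep_iff]
  intro A hA
  refine ⟨fun s => ∫⁻ u in A, ENNReal.ofReal (f j (Function.update (extendZero S s) j u)),
    (hf.measurable_setLIntegral_update j A).comp (measurable_extendZero S), fun B C hB hC => ?_⟩
  rw [← hf.setLIntegral_eq_measure hfS hS hS hk hA hB hC]
  refine lintegral_congr fun z => lintegral_congr fun u => ?_
  rw [update_congr hfS fun l hl => (extendZero_coords hl z).symm]

/-- The integrated factor and the function supplied by conditional independence are both versions of
the probability of `Z_j ∈ A` given `Z_S` and `Z_k`. They agree almost surely, hence Lebesgue-a.e.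
because the joint density is positive. -/
theorem ae_eq_of_coordCondIndep (hf : MarkovFactors G f) {j k : Fin n} {S : Set (Fin n)}
    (hfS : DependsOn (f j) (insert j (insert k S))) (hS : ∀ l ∈ S, ¬ G.Reach j l)
    (hk : ¬ G.Reach j k) (h : CoordCondIndep (factorLaw f) k j S) {A : Set ℝ}
    (hA : MeasurableSet A) :
    ∃ H : (S → ℝ) → ℝ≥0∞, ∀ᵐ z : Fin n → ℝ,
      ∫⁻ u in A, ENNReal.ofReal (f j (Function.update z j u)) = H (coords S z) := by
  have := hf.isProbabilityMeasure
  have hkm : Measurable fun z : Fin n → ℝ => z k := measurable_pi_apply k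
  obtain ⟨H, hH, hHA⟩ := coordCondIndep_iff.1 h A hA
  refine ⟨H, ?_⟩
  have hT : ∀ l ∈ insert k S, ¬ G.Reach j l := by
    rintro l (rfl | hl)
    · exact hk
    · exact hS l hl
  set X : (Fin n → ℝ) → (S → ℝ) × ℝ := fun z => (coords S z, z k) with hX
  have hXm : Measurable X := (measurable_coords S).prodMk hkm
  set K : (S → ℝ) × ℝ → ℝ≥0∞ := fun p => ∫⁻ u in A,
    ENNReal.ofReal (f j (Function.update (Function.update (extendZero S p.1) k p.2) j u)) with hK
  have hKm : Measurable K := (hf.measurable_setLIntegral_update j A).comp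
    (measurable_update'.comp
      (((measurable_extendZero S).comp measurable_fst).prodMk measurable_snd))
  have hKX : ∀ z, ∫⁻ u in A, ENNReal.ofReal (f j (Function.update z j u)) = K (X z) := by
    intro z
    refine lintegral_congr fun u => ?_
    rw [update_congr hfS (w := Function.update (extendZero S (coords S z)) k (z k))]
    intro l hl
    by_cases hlk : l = k
    · subst hlk; simp
    · rw [Function.update_of_ne hlk, extendZero_coords (hl.resolve_left hlk)]
  have hHm : Measurable fun p : (S → ℝ) × ℝ => H p.1 := hH.comp measurable_fst
  have hrect : ∀ (C : Set (S → ℝ)) (B : Set ℝ), MeasurableSet C → MeasurableSet B →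
      ((factorLaw f).map X).withDensity K (C ×ˢ B) =
        ((factorLaw f).map X).withDensity (fun p => H p.1) (C ×ˢ B) := by
    intro C B hC hB
    rw [withDensity_apply _ (hC.prod hB), withDensity_apply _ (hC.prod hB),
      setLIntegral_map (hC.prod hB) hKm hXm, setLIntegral_map (hC.prod hB) hHm hXm]
    have hpre : X ⁻¹' (C ×ˢ B) = coords S ⁻¹' C ∩ (fun z => z k) ⁻¹' B := Set.mk_preimage_prod _ _
    simp only [← hKX]
    rw [hpre, hf.setLIntegral_eq_measure hfS hT hS hk hA hB hC, hHA B C hB hC]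
  have hfin : IsFiniteMeasure (((factorLaw f).map X).withDensity K) := by
    refine isFiniteMeasure_withDensity ?_
    rw [lintegral_map hKm hXm]
    have h1 := hf.setLIntegral_eq_measure hfS hT hS hk hA MeasurableSet.univ MeasurableSet.univ
    simp only [Set.preimage_univ, Set.univ_inter, Measure.restrict_univ, hKX] at h1
    rw [h1]
    exact measure_ne_top _ _
  have hmeas := Measure.ext_prod_iff.2 fun {C} {B} hC hB => hrect C B hC hB
  rw [withDensity_eq_iff_of_sigmaFinite hKm.aemeasurable hHm.aemeasurable] at hmeas
  have h2 := ae_of_ae_map hXm.aemeasurable hmeas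
  rw [factorLaw, ae_withDensity_iff
    (continuous_finsetProd _ fun i _ => hf.continuous i).measurable.ennreal_ofReal] at h2
  filter_upwards [h2] with z hz
  rw [hKX]
  refine hz ?_
  rw [Ne, ENNReal.ofReal_eq_zero, not_le]
  exact Finset.prod_pos fun i _ => hf.pos i z

/-- A strict inequality at one point persists nearby by continuity, so integrating over a small
interval in `z_j` gives different probabilities at two points with the same coordinates in `S`. -/
theorem not_lt_of_coordCondIndep (hf : MarkovFactors G f) {j k : Fin n} {S : Set (Fin n)}
    (hfS : DependsOn (f j) (insert j (insert k S))) (hS : ∀ l ∈ S, ¬ G.Reach j l)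
    (hk : ¬ G.Reach j k) (hkS : k ∉ S) (h : CoordCondIndep (factorLaw f) k j S)
    (z₀ : Fin n → ℝ) (δ : ℝ) : ¬ f j z₀ < f j (z₀ + Pi.single k δ) := by
  intro hlt
  have hkj : j ≠ k := by
    rintro rfl
    exact hk Relation.ReflTransGen.refl
  obtain ⟨c, hc0, hc1⟩ := exists_between hlt
  obtain ⟨d, hd0, hd1⟩ := exists_between hc1
  have hcpos : 0 < c := (hf.pos j z₀).trans hc0
  have hcont : Continuous fun z => f j (z + Pi.single k δ) :=
    (hf.continuous j).comp (continuous_id.add continuous_const)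
  obtain ⟨ε, hε, hball⟩ := Metric.eventually_nhds_iff_ball.1
    (((hf.continuous j).continuousAt.eventually_lt continuousAt_const hc0).and
      (continuousAt_const.eventually_lt hcont.continuousAt hd1))
  set A : Set ℝ := Metric.ball (z₀ j) ε with hA
  have hupd : ∀ z ∈ Metric.ball z₀ ε, ∀ u ∈ A, Function.update z j u ∈ Metric.ball z₀ ε := by
    intro z hz u hu
    rw [Metric.mem_ball, dist_pi_lt_iff hε] at hz ⊢
    intro l
    by_cases hl : l = j
    · subst hl; simpa [hA] using hu
    · rw [Function.update_of_ne hl]; exact hz l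
  obtain ⟨H, hH⟩ := hf.ae_eq_of_coordCondIndep hfS hS hk h (A := A) measurableSet_ball
  have hτ : MeasurePreserving (fun z : Fin n → ℝ => z + Pi.single k δ) volume volume :=
    measurePreserving_add_right volume _
  have hH' := hτ.quasiMeasurePreserving.ae hH
  -- Translation preserves null sets, so some `z` near `z₀` is good together with its translate
  -- along `k`.
  obtain ⟨z, hz, hz1, hz2⟩ := (Measure.dense_of_ae (hH.and hH')).inter_open_nonempty
    (Metric.ball z₀ ε) Metric.isOpen_ball ⟨z₀, Metric.mem_ball_self hε⟩
  have hcoords : coords S (z + Pi.single k δ) = coords S z := by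
    funext l
    have : (l : Fin n) ≠ k := fun h => hkS (h ▸ l.2)
    simp [coords, this]
  rw [hcoords, ← hz1] at hz2
  have hlow : ENNReal.ofReal d * volume A ≤
      ∫⁻ u in A, ENNReal.ofReal (f j (Function.update (z + Pi.single k δ) j u)) := by
    rw [← setLIntegral_const]
    refine setLIntegral_mono' measurableSet_ball fun u hu => ENNReal.ofReal_le_ofReal ?_
    have h1 := (hball _ (hupd z hz u hu)).2
    have h2 : Function.update (z + Pi.single k δ) j u =
        Function.update z j u + Pi.single k δ := by
      funext l
      by_cases hl : l = j
      · subst hl; simp [hkj]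
      · simp [hl]
    rw [h2]
    exact h1.le
  have hupp : ∫⁻ u in A, ENNReal.ofReal (f j (Function.update z j u)) ≤
      ENNReal.ofReal c * volume A := by
    rw [← setLIntegral_const]
    exact setLIntegral_mono' measurableSet_ball fun u hu => ENNReal.ofReal_le_ofReal
      (hball _ (hupd z hz u hu)).1.le
  have hA0 : volume A ≠ 0 := (Metric.measure_ball_pos volume _ hε).ne'
  have hA1 : volume A ≠ ∞ := measure_ball_lt_top.ne
  have h3 : ENNReal.ofReal d * volume A ≤ ENNReal.ofReal c * volume A :=
    hlow.trans (hz2.le.trans hupp)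
  rw [ENNReal.mul_le_mul_iff_left hA0 hA1, ENNReal.ofReal_le_ofReal_iff hcpos.le] at h3
  exact absurd hd0 (not_lt.2 h3)

/-- If a node is conditionally independent of a variable given the other variables that determine
its factor, then its factor does not depend on that variable. -/
theorem update_eq_of_coordCondIndep (hf : MarkovFactors G f) {j k : Fin n} {S : Set (Fin n)}
    (hfS : DependsOn (f j) (insert j (insert k S))) (hS : ∀ l ∈ S, ¬ G.Reach j l)
    (hk : ¬ G.Reach j k) (hkS : k ∉ S) (h : CoordCondIndep (factorLaw f) k j S)
    (z : Fin n → ℝ) (t : ℝ) : f j (Function.update z k t) = f j z := by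
  have key := hf.not_lt_of_coordCondIndep hfS hS hk hkS h
  have e1 : z + Pi.single k (t - z k) = Function.update z k t := by
    funext l
    by_cases hl : l = k
    · subst hl; simp
    · simp [hl]
  have e2 : Function.update z k t + Pi.single k (z k - t) = z := by
    funext l
    by_cases hl : l = k
    · subst hl; simp
    · simp [hl]
  have h1 := key z (t - z k)
  have h2 := key (Function.update z k t) (z k - t)
  rw [e1] at h1
  rw [e2] at h2
  exact le_antisymm (not_lt.1 h1) (not_lt.1 h2)

end MarkovFactors

theorem dependsOn_of_update_eq {n : ℕ} {β : Type*} {F : (Fin n → ℝ) → β} {S : Set (Fin n)}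
    (h : ∀ i, i ∉ S → ∀ y t, F (Function.update y i t) = F y) : DependsOn F S := by
  classical
  intro x y hxy
  have key : ∀ T : Finset (Fin n), (∀ i ∈ T, i ∉ S) → F (T.piecewise x y) = F y := by
    intro T
    induction T using Finset.induction_on with
    | empty => intro _; simp
    | insert i T _ ih =>
      intro hT
      rw [Finset.piecewise_insert, h i (hT i (Finset.mem_insert_self _ _)),
        ih fun l hl => hT l (Finset.mem_insert_of_mem hl)]
  have h1 := key (Finset.univ.filter fun i => i ∉ S) (by simp)
  have h2 : (Finset.univ.filter fun i => i ∉ S).piecewise x y = x := by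
    funext i
    by_cases hi : i ∈ S
    · simp [hi, hxy i hi]
    · simp [hi]
  rwa [h2] at h1

/-! ### Interventional discrepancy -/

/-- If `c` took two values, its range would contain the interval between them. The ratio would be
constant there, with zero derivative on a set of positive measure. -/
theorem InterventionalDiscrepancy.eq_of_log_sub_log_eq {p q : ℝ → ℝ}
    (h : InterventionalDiscrepancy p q) (hp : ∀ u, 0 < p u) (hq : ∀ u, 0 < q u)
    {c : ℝ → ℝ} (hc : Continuous c)
    (hconst : ∀ s t, Real.log (p (c s)) - Real.log (q (c s)) =
      Real.log (p (c t)) - Real.log (q (c t))) (s t : ℝ) : c s = c t := by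
  by_contra hne
  obtain ⟨T, hT, hd⟩ := h
  have hsub : Set.uIcc (c s) (c t) ⊆ Set.range c := by
    refine (intermediate_value_uIcc hc.continuousOn).trans (Set.image_subset_range _ _)
  have hratio : ∀ u ∈ Set.range c, p u / q u = p (c s) / q (c s) := by
    rintro _ ⟨r, rfl⟩
    refine Real.log_injOn_pos (div_pos (hp _) (hq _)) (div_pos (hp _) (hq _)) ?_
    rw [Real.log_div (hp _).ne' (hq _).ne', Real.log_div (hp _).ne' (hq _).ne']
    exact hconst r s
  set J : Set ℝ := Set.Ioo (min (c s) (c t)) (max (c s) (c t)) with hJ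
  have hJT : J ⊆ T := by
    intro u hu
    by_contra huT
    refine hd u huT ?_
    have : (fun v => p v / q v) =ᶠ[nhds u] fun _ => p (c s) / q (c s) := by
      filter_upwards [isOpen_Ioo.mem_nhds hu] with v hv
      exact hratio v (hsub (Set.Ioo_subset_Icc_self hv))
    rw [this.deriv_eq, deriv_const]
  have h0 := measure_mono_null hJT hT
  rw [hJ, Real.volume_Ioo, ENNReal.ofReal_eq_zero, sub_nonpos] at h0
  exact absurd (min_lt_max.2 hne) (not_lt.2 h0)

/-! ### The laws of a model as Markov factorizations -/

namespace Model

variable {n d : ℕ} (M : Model n d)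

/-- The observational mechanism of node `i` as a function on the latent space. -/
def mechFactor (i : Fin n) (z : Fin n → ℝ) : ℝ := M.mech i (z i) fun j => z j

/-- The factors after the intervention that replaces the mechanism of `l` by `r`. -/
def intFactor (r : ℝ → ℝ) (l i : Fin n) (z : Fin n → ℝ) : ℝ :=
  if i = l then r (z l) else M.mechFactor i z

theorem mechFactor_contDiff (i : Fin n) : ContDiff ℝ 1 (M.mechFactor i) :=
  (M.mech_contDiff i).comp (f := fun z : Fin n → ℝ => (z i, fun j : M.graph.pa i => z j))
    ((contDiff_apply ℝ ℝ i).prodMk (contDiff_pi.2 fun j => contDiff_apply ℝ ℝ (j : Fin n)))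

theorem mechFactor_pos (i : Fin n) (z : Fin n → ℝ) : 0 < M.mechFactor i z :=
  (M.mech_pdf i _).pos _

theorem dependsOn_mechFactor (i : Fin n) :
    DependsOn (M.mechFactor i) (insert i (M.graph.pa i : Set (Fin n))) := by
  intro x y h
  rw [mechFactor, mechFactor, h i (Set.mem_insert _ _)]
  congr 1
  funext j
  exact h j (Set.mem_insert_of_mem _ j.2)

theorem mechFactor_update_self (i : Fin n) (z : Fin n → ℝ) (u : ℝ) :
    M.mechFactor i (Function.update z i u) = M.mech i u fun j => z j := by
  rw [mechFactor, Function.update_self]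
  congr 1
  funext j
  refine Function.update_of_ne ?_ _ _
  intro hj
  have h2 : (j : Fin n) ∈ M.graph.pa i := j.2
  rw [hj] at h2
  exact M.graph.notMem_pa_self i h2

theorem markovFactors_mechFactor : MarkovFactors M.graph M.mechFactor where
  continuous i := (M.mechFactor_contDiff i).continuous
  pos := M.mechFactor_pos
  dependsOn := M.dependsOn_mechFactor
  lintegral_update i z := by
    simp only [mechFactor_update_self]
    exact (M.mech_pdf i _).lintegral_eq_one

variable {r : ℝ → ℝ} (l : Fin n)

theorem intFactor_self (r : ℝ → ℝ) (z : Fin n → ℝ) : M.intFactor r l l z = r (z l) := if_pos rfl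

theorem intFactor_of_ne (r : ℝ → ℝ) {i : Fin n} (h : i ≠ l) :
    M.intFactor r l i = M.mechFactor i :=
  funext fun _ => if_neg h

theorem intFactor_contDiff (hr : IsSmoothPosPDF r) (i : Fin n) :
    ContDiff ℝ 1 (M.intFactor r l i) := by
  by_cases h : i = l
  · subst h
    have : M.intFactor r i i = fun z => r (z i) := funext fun z => M.intFactor_self i r z
    rw [this]
    exact hr.contDiff.comp (contDiff_apply ℝ ℝ i)
  · rw [M.intFactor_of_ne l r h]
    exact M.mechFactor_contDiff i

theorem dependsOn_intFactor_self (r : ℝ → ℝ) : DependsOn (M.intFactor r l l) {l} := by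
  intro x y h
  rw [intFactor_self, intFactor_self, h l rfl]

theorem markovFactors_intFactor (hr : IsSmoothPosPDF r) :
    MarkovFactors M.graph (M.intFactor r l) where
  continuous i := (M.intFactor_contDiff l hr i).continuous
  pos i z := by
    by_cases h : i = l
    · subst h; rw [intFactor_self]; exact hr.pos _
    · rw [M.intFactor_of_ne l r h]; exact M.mechFactor_pos i z
  dependsOn i := by
    by_cases h : i = l
    · subst h
      exact (M.dependsOn_intFactor_self i r).mono (by simp)
    · rw [M.intFactor_of_ne l r h]; exact M.dependsOn_mechFactor i
  lintegral_update i z := by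
    by_cases h : i = l
    · subst h
      simpa only [intFactor_self, Function.update_self] using hr.lintegral_eq_one
    · rw [M.intFactor_of_ne l r h]
      exact M.markovFactors_mechFactor.lintegral_update i z

theorem intPDF_eq_prod (r : ℝ → ℝ) (z : Fin n → ℝ) :
    M.intPDF r l z = ∏ i, M.intFactor r l i z := by
  rw [← Finset.mul_prod_erase _ _ (Finset.mem_univ l), intPDF, intFactor_self]
  congr 1
  refine Finset.prod_congr rfl fun i hi => ?_
  rw [M.intFactor_of_ne l r (Finset.ne_of_mem_erase hi)]
  rfl

theorem intPDF_contDiff (hr : IsSmoothPosPDF r) : ContDiff ℝ 1 (M.intPDF r l) := by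
  have : M.intPDF r l = fun z => ∏ i, M.intFactor r l i z := funext (M.intPDF_eq_prod l r)
  rw [this]
  exact contDiff_prod fun i _ => M.intFactor_contDiff l hr i

theorem intPDF_pos (hr : IsSmoothPosPDF r) (z : Fin n → ℝ) : 0 < M.intPDF r l z := by
  rw [intPDF_eq_prod]
  exact Finset.prod_pos fun i _ => (M.markovFactors_intFactor l hr).pos i z

/-- The sum over all nodes is the same for every intervention and cancels in each difference of two
environments. -/
theorem log_intPDF (hr : IsSmoothPosPDF r) (z : Fin n → ℝ) :
    Real.log (M.intPDF r l z) = Real.log (r (z l)) - Real.log (M.mechFactor l z) +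
      ∑ i, Real.log (M.mechFactor i z) := by
  change Real.log (r (z l) * ∏ i ∈ Finset.univ.erase l, M.mechFactor i z) = _
  rw [Real.log_mul (hr.pos _).ne' (Finset.prod_pos fun i _ => M.mechFactor_pos i z).ne',
    ← Finset.add_sum_erase _ _ (Finset.mem_univ l),
    Real.log_prod fun i _ => (M.mechFactor_pos i z).ne']
  ring

theorem lawE_eq_factorLaw (m : Fin n) :
    M.lawE m = factorLaw (M.intFactor (M.q (M.target m)) (M.target m)) := by
  simp only [lawE, factorLaw, intPDF_eq_prod]

theorem lawE'_eq_factorLaw (m : Fin n) :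
    M.lawE' m = factorLaw (M.intFactor (M.q' (M.target m)) (M.target m)) := by
  simp only [lawE', factorLaw, intPDF_eq_prod]

/-! ### Encoders -/

theorem measurableEmbedding_g : MeasurableEmbedding M.g :=
  M.g_contDiff.continuous.measurableEmbedding (Function.LeftInverse.injective M.gInv_g)

theorem g_gInv {x : Fin d → ℝ} (hx : x ∈ Set.range M.g) : M.g (M.gInv x) = x := by
  obtain ⟨z, rfl⟩ := hx
  rw [M.gInv_g]

variable {h : (Fin d → ℝ) → (Fin n → ℝ)}

theorem exists_isDiffeoPair (hv : M.data.IsValidEncoder h) :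
    ∃ χ, IsDiffeoPair (h ∘ M.g) χ := by
  obtain ⟨hh, k, hk, hkX, hkh, hhk⟩ := hv
  have hkm : ∀ y, k y ∈ Set.range M.g := fun y => by
    have : k y ∈ Set.range k := ⟨y, rfl⟩
    rwa [hkX] at this
  refine ⟨M.gInv ∘ k, hh.comp_contDiff M.g_contDiff fun z => ⟨z, rfl⟩,
    M.gInv_contDiffOn.comp_contDiff hk hkm, fun z => ?_, fun y => ?_⟩
  · simp only [Function.comp_apply]
    rw [hkh _ ⟨z, rfl⟩, M.gInv_g]
  · simp only [Function.comp_apply]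
    rw [M.g_gInv (hkm y), hhk]

theorem map_map_g (hψ : Measurable (h ∘ M.g)) (μ : Measure (Fin n → ℝ)) :
    (μ.map M.g).map h = μ.map (h ∘ M.g) := by
  refine AEMeasurable.map_map_of_aemeasurable ?_ M.measurableEmbedding_g.measurable.aemeasurable
  exact M.measurableEmbedding_g.aemeasurable_map_iff.2 hψ.aemeasurable

theorem latE_eq (hψ : Measurable (h ∘ M.g)) (m : Fin n) :
    M.data.latE h m = (M.lawE m).map (h ∘ M.g) := M.map_map_g hψ _

theorem latE'_eq (hψ : Measurable (h ∘ M.g)) (m : Fin n) :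
    M.data.latE' h m = (M.lawE' m).map (h ∘ M.g) := M.map_map_g hψ _

theorem scoreChange_eq_zero_iff {χ : (Fin n → ℝ) → (Fin n → ℝ)} (H : IsDiffeoPair (h ∘ M.g) χ)
    (a b k : Fin n) :
    scoreChange (M.data.latE h a) (M.data.latE' h b) k = 0 ↔ ∀ y t,
      Real.log (M.intPDF (M.q (M.target a)) (M.target a) (χ (Function.update y k t))) -
        Real.log (M.intPDF (M.q' (M.target b)) (M.target b) (χ (Function.update y k t))) =
      Real.log (M.intPDF (M.q (M.target a)) (M.target a) (χ y)) -
        Real.log (M.intPDF (M.q' (M.target b)) (M.target b) (χ y)) := by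
  have hψ := H.contDiff.continuous.measurable
  rw [M.latE_eq hψ, M.latE'_eq hψ]
  exact H.scoreChange_map_eq_zero_iff (M.intPDF_contDiff _ (M.q_pdf _))
    (M.intPDF_contDiff _ (M.q'_pdf _)) (M.intPDF_pos _ (M.q_pdf _)) (M.intPDF_pos _ (M.q'_pdf _)) k

theorem scoreChangeMatrix_eq_zero_iff (hD : M.Discrepancy) {χ : (Fin n → ℝ) → (Fin n → ℝ)}
    (H : IsDiffeoPair (h ∘ M.g) χ) (k m : Fin n) :
    M.data.scoreChangeMatrix h k m = 0 ↔
      ∀ y t, χ (Function.update y k t) (M.target m) = χ y (M.target m) := by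
  rw [Data.scoreChangeMatrix, Matrix.of_apply, M.scoreChange_eq_zero_iff H]
  have hlog : ∀ z, Real.log (M.intPDF (M.q (M.target m)) (M.target m) z) -
      Real.log (M.intPDF (M.q' (M.target m)) (M.target m) z) =
      Real.log (M.q (M.target m) (z (M.target m))) -
        Real.log (M.q' (M.target m) (z (M.target m))) := fun z => by
    rw [M.log_intPDF _ (M.q_pdf _), M.log_intPDF _ (M.q'_pdf _)]
    ring
  simp only [hlog]
  constructor
  · intro hz y t
    have hc : Continuous fun t => χ (Function.update y k t) (M.target m) :=
      (continuous_apply _).comp (H.contDiff_inv.continuous.comp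
        (continuous_const.update k continuous_id))
    have := (hD (M.target m)).eq_of_log_sub_log_eq (M.q_pdf _).pos (M.q'_pdf _).pos hc
      (fun s t => by rw [hz y s, hz y t]) t (y k)
    simpa using this
  · intro hz y t
    rw [hz]

/-- A valid encoder with diagonal score change matrix recovers each intervened latent variable up
to a diffeomorphism. -/
theorem exists_eq_permMap (hD : M.Discrepancy) (hv : M.data.IsValidEncoder h)
    (hdiag : (M.data.scoreChangeMatrix h).IsDiag) :
    ∃ φ c : Fin n → ℝ → ℝ, (∀ m, ContDiff ℝ 1 (φ m)) ∧ (∀ m, ContDiff ℝ 1 (c m)) ∧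
      (∀ m u, c m (φ m u) = u) ∧ (∀ m u, φ m (c m u) = u) ∧
      h ∘ M.g = permMap M.target φ ∧
      IsDiffeoPair (h ∘ M.g) fun y l => c (M.target.symm l) (y (M.target.symm l)) := by
  obtain ⟨χ, H⟩ := M.exists_isDiffeoPair hv
  set ψ := h ∘ M.g with hψ
  set I := M.target with hI
  have hχ : ∀ m, DependsOn (fun y => χ y (I m)) {m} := fun m =>
    dependsOn_of_update_eq fun i hi y t =>
      (M.scoreChangeMatrix_eq_zero_iff hD H i m).1 (hdiag hi) y t
  -- Freezing the other coordinates at `0` is an arbitrary choice: by `hχ`, the latent coordinate `I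
  -- m` is a function of `y m` alone.
  let φ : Fin n → ℝ → ℝ := fun m u => ψ (Function.update 0 (I m) u) m
  let c : Fin n → ℝ → ℝ := fun m u => χ (Function.update 0 m u) (I m)
  have hc : ∀ y m, χ y (I m) = c m (y m) := fun y m => hχ m (by simp)
  have hcψ : ∀ z m, c m (ψ z m) = z (I m) := fun z m => by rw [← hc, H.left_inv]
  have hinj : ∀ m, Function.Injective (c m) := by
    intro m s t hst
    have h1 : χ (Function.update 0 m s) = χ (Function.update 0 m t) := by
      funext l
      obtain ⟨m', rfl⟩ := I.surjective l
      rw [hc, hc]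
      by_cases hm : m' = m
      · subst hm; simpa using hst
      · simp [hm]
    have h2 := congrArg ψ h1
    rw [H.right_inv, H.right_inv] at h2
    simpa using congrFun h2 m
  have hcφ : ∀ m u, c m (φ m u) = u := fun m u => by
    change c m (ψ _ m) = u
    rw [hcψ, Function.update_self]
  have hφc : ∀ m u, φ m (c m u) = u := fun m u => hinj m (hcφ m _)
  have hupd : ∀ m : Fin n, ContDiff ℝ 1 fun u : ℝ => Function.update (0 : Fin n → ℝ) m u :=
    fun m => contDiff_update (𝕜 := ℝ) 1 (0 : Fin n → ℝ) m
  refine ⟨φ, c, fun m => ?_, fun m => ?_, hcφ, hφc, ?_, ?_⟩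
  · exact (contDiff_apply ℝ ℝ m).comp (H.contDiff.comp (hupd _))
  · exact (contDiff_apply ℝ ℝ (I m)).comp (H.contDiff_inv.comp (hupd _))
  · funext z m
    refine hinj m ?_
    rw [hcψ]
    exact (hcφ m _).symm
  · have : (fun (y : Fin n → ℝ) l => c (I.symm l) (y (I.symm l))) = χ := by
      funext y l
      rw [← hc, I.apply_symm_apply]
    rw [this]
    exact H

theorem perfectLatentRecovery (hD : M.Discrepancy) (hv : M.data.IsValidEncoder h)
    (hdiag : (M.data.scoreChangeMatrix h).IsDiag) : PerfectLatentRecovery M h := by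
  obtain ⟨φ, c, hφ, hc, hcφ, hφc, hψ, -⟩ := M.exists_eq_permMap hD hv hdiag
  refine ⟨M.target, fun l => φ (M.target.symm l), fun l => ⟨hφ _, c _, hc _, hcφ _, hφc _⟩,
    fun z i => ?_⟩
  have := congrFun (congrFun hψ z) i
  simpa [permMap] using this

/-- The witness is the true inverse of `g` with its coordinates ordered by intervention target. -/
theorem exists_valid_diagonal (hD : M.Discrepancy) :
    ∃ h, M.data.IsValidEncoder h ∧ (M.data.scoreChangeMatrix h).IsDiag := by
  set h : (Fin d → ℝ) → (Fin n → ℝ) := fun x m => M.gInv x (M.target m) with hh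
  have hperm : ∀ I : Equiv.Perm (Fin n), ContDiff ℝ 1 fun (z : Fin n → ℝ) l => z (I l) :=
    fun I => contDiff_pi.2 fun l => contDiff_apply ℝ ℝ (I l)
  have hgh : ∀ z m, h (M.g z) m = z (M.target m) := fun z m => by rw [hh]; simp only [M.gInv_g]
  refine ⟨h, ⟨(hperm M.target).comp_contDiffOn M.gInv_contDiffOn,
    fun y => M.g fun l => y (M.target.symm l), M.g_contDiff.comp (hperm _), ?_, ?_, ?_⟩, ?_⟩
  · refine Set.Subset.antisymm (Set.range_subset_iff.2 fun y => ⟨_, rfl⟩) ?_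
    rintro _ ⟨z, rfl⟩
    exact ⟨fun m => z (M.target m), by simp⟩
  · rintro _ ⟨z, rfl⟩
    simp [hgh]
  · intro y
    funext m
    simp [hgh]
  · have H : IsDiffeoPair (h ∘ M.g) fun y l => y (M.target.symm l) := by
      refine ⟨?_, hperm _, fun z => ?_, fun y => ?_⟩
      · have : h ∘ M.g = fun z m => z (M.target m) := funext fun z => funext fun m => hgh z m
        rw [this]
        exact hperm _
      · funext l; simp [hgh]
      · funext m; simp [hgh]
    intro k m hkm
    rw [M.scoreChangeMatrix_eq_zero_iff hD H]
    intro y t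
    simp [Ne.symm hkm]

theorem exists_isOptimalEncoder (hD : M.Discrepancy) : ∃ h, M.data.IsOptimalEncoder h := by
  obtain ⟨h, ⟨hv, hd⟩, hmin⟩ := (measure M.data.numScoreChanges).wf.has_min
    {h | M.data.IsValidEncoder h ∧ (M.data.scoreChangeMatrix h).IsDiag}
    (M.exists_valid_diagonal hD)
  exact ⟨h, hv, hd, fun h' hv' hd' => not_lt.1 (hmin h' ⟨hv', hd'⟩)⟩

end Model

/-! ### Additive noise -/

/-- A positive continuous probability density is not multiplied by a constant under a nonzero
translation. -/
theorem eq_zero_of_log_translate {ν : ℝ → ℝ} (hc : Continuous ν) (hpos : ∀ u, 0 < ν u)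
    (hint : ∫⁻ u, ENNReal.ofReal (ν u) = 1) {δ C : ℝ}
    (h : ∀ u, Real.log (ν (u + δ)) - Real.log (ν u) = C) : δ = 0 := by
  have hmul : ∀ u, ν (u + δ) = Real.exp C * ν u := fun u => by
    rw [← h u, Real.exp_sub, Real.exp_log (hpos _), Real.exp_log (hpos _),
      div_mul_cancel₀ _ (hpos u).ne']
  -- Translation preserves the integral, which forces the multiplier to be `1` and makes `ν`
  -- periodic.
  have hexp : Real.exp C = 1 := by
    have h1 := lintegral_add_right_eq_self (μ := volume) (fun u => ENNReal.ofReal (ν u)) δ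
    simp only [hmul, ENNReal.ofReal_mul (Real.exp_pos C).le] at h1
    rw [lintegral_const_mul _ hc.measurable.ennreal_ofReal, hint, mul_one,
      ENNReal.ofReal_eq_one] at h1
    exact h1
  have hper : Function.Periodic ν δ := fun u => by rw [hmul, hexp, one_mul]
  have hper' : Function.Periodic ν |δ| := by
    rcases abs_choice δ with h | h <;> rw [h]
    · exact hper
    · exact hper.neg
  by_contra hδ
  -- A positive function with a nonzero period has unbounded integrals over `[0, t]`, against
  -- integrability.
  have hlim := hper'.tendsto_atTop_intervalIntegral_of_pos' (hc.intervalIntegrable _ _) hpos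
    (abs_pos.2 hδ)
  have hI : Integrable ν := by
    refine ⟨hc.aestronglyMeasurable, ?_⟩
    rw [hasFiniteIntegral_iff_ofReal (Filter.Eventually.of_forall fun u => (hpos u).le), hint]
    exact ENNReal.one_lt_top
  obtain ⟨t, ht, ht0⟩ := ((hlim.eventually_gt_atTop (∫ u, ν u)).and
    (Filter.eventually_ge_atTop 0)).exists
  rw [intervalIntegral.integral_of_le ht0] at ht
  exact absurd ht (not_lt.2 (setIntegral_le_integral hI
    (Filter.Eventually.of_forall fun u => (hpos u).le)))

namespace DAG

variable {n : ℕ}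

theorem not_reach_of_pa_eq_empty (G : DAG n) {j k : Fin n} (hk : G.pa k = ∅) (hkj : k ≠ j) :
    ¬ G.Reach j k := by
  intro h
  rcases Relation.ReflTransGen.cases_tail h with h | ⟨l, -, hl⟩
  · exact hkj h
  · rw [hk] at hl
    exact absurd hl (Finset.notMem_empty _)

/-- The graph in which node `i` plays the role of node `I i` of `G`. -/
def relabel (G : DAG n) (I : Equiv.Perm (Fin n)) : DAG n where
  pa i := (G.pa (I i)).map I.symm.toEmbedding
  acyclic i h := G.acyclic (I i) (Relation.TransGen.lift (p := fun j k => j ∈ G.pa k) I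
    (fun a b hab => by
      obtain ⟨l, hl, rfl⟩ := Finset.mem_map.1 hab
      simpa [Function.onFun] using hl) _ _ h)

theorem mem_relabel_pa (G : DAG n) (I : Equiv.Perm (Fin n)) {k j : Fin n} :
    k ∈ (G.relabel I).pa j ↔ I k ∈ G.pa (I j) := by
  simp only [relabel, Finset.mem_map_equiv, Equiv.symm_symm]

theorem relabel_pa_eq_empty (G : DAG n) (I : Equiv.Perm (Fin n)) {j : Fin n} :
    (G.relabel I).pa j = ∅ ↔ G.pa (I j) = ∅ := by
  simp only [relabel, Finset.map_eq_empty]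

end DAG

/-! ### Dependence on parents and non-cancellation of mechanisms. -/

namespace Model

variable {n d : ℕ} (M : Model n d)

theorem dependsOn_mechFactor_of_update_eq {j k : Fin n}
    (h : ∀ z t, M.mechFactor j (Function.update z k t) = M.mechFactor j z) :
    DependsOn (M.mechFactor j) (insert j ((M.graph.pa j : Set (Fin n)) \ {k})) := by
  refine dependsOn_of_update_eq fun i hi y t => ?_
  by_cases hik : i = k
  · subst hik
    exact h y t
  · refine M.dependsOn_mechFactor j fun l hl => Function.update_of_ne ?_ _ _
    rintro rfl
    refine hi ?_
    rcases hl with hl | hl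
    · exact Or.inl hl
    · exact Or.inr ⟨hl, hik⟩

/-- Under adjacency-faithfulness, each mechanism depends on each parent. -/
theorem AdjacencyFaithful.exists_update_ne (hF : M.AdjacencyFaithful) {k j : Fin n}
    (hk : k ∈ M.graph.pa j) :
    ∃ z t, M.mechFactor j (Function.update z k t) ≠ M.mechFactor j z := by
  by_contra! h
  -- If the mechanism ignored `k`, the other parents would determine it, and the local Markov
  -- property would separate `j` from its parent `k`.
  refine hF k j hk ((M.graph.pa j : Set (Fin n)) \ {k}) (by simp)
    (fun hj => M.graph.notMem_pa_self j hj.1) ?_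
  exact M.markovFactors_mechFactor.coordCondIndep (M.dependsOn_mechFactor_of_update_eq h)
    (fun l hl => M.graph.not_reach_of_mem_pa hl.1) (M.graph.not_reach_of_mem_pa hk)

theorem mechFactor_update_of_notMem {j k : Fin n} (hkj : k ≠ j) (hk : k ∉ M.graph.pa j)
    (z : Fin n → ℝ) (t : ℝ) : M.mechFactor j (Function.update z k t) = M.mechFactor j z := by
  refine M.dependsOn_mechFactor j fun l hl => Function.update_of_ne ?_ _ _
  rintro rfl
  rcases hl with hl | hl
  · exact hkj hl
  · exact hk hl

theorem AdditiveNoise.mech_eq (hN : M.AdditiveNoise) {a : Fin n} {w w' : M.graph.pa a → ℝ} {C : ℝ}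
    (h : ∀ u, Real.log (M.mech a u w') - Real.log (M.mech a u w) = C) (u : ℝ) :
    M.mech a u w' = M.mech a u w := by
  obtain ⟨f, ν, hpos, hint, hmech⟩ := hN a
  have hc : Continuous ν := by
    have h1 : ν = fun u => M.mech a (u + f w) w := funext fun u => by
      rw [hmech, add_sub_cancel_right]
    rw [h1]
    exact (M.mech_pdf a w).contDiff.continuous.comp (continuous_id.add continuous_const)
  have h0 : f w - f w' = 0 := eq_zero_of_log_translate hc hpos hint (C := C) fun v => by
    rw [← h (v + f w), hmech, hmech, add_sub_cancel_right, add_sub_assoc]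
  rw [hmech, hmech, sub_eq_zero.1 h0]

/-- Here `p_b` does not involve `z_a`. Varying `z_a` then shows that changing `z_k` multiplies the
density `p_a` by a constant, so by additive noise it does not change it at all. -/
theorem exists_log_mechFactor_sub_ne_of_notMem (hN : M.AdditiveNoise) (hF : M.AdjacencyFaithful)
    {a b k : Fin n} (hab : a ≠ b) (ha : a ∉ M.graph.pa b) (hka : k ∈ M.graph.pa a) :
    ¬ ∀ z t, Real.log (M.mechFactor a (Function.update z k t)) -
        Real.log (M.mechFactor b (Function.update z k t)) =
      Real.log (M.mechFactor a z) - Real.log (M.mechFactor b z) := by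
  intro h
  obtain ⟨z, t, hne⟩ := AdjacencyFaithful.exists_update_ne M hF hka
  have hk : k ≠ a := by
    rintro rfl
    exact M.graph.notMem_pa_self _ hka
  refine hne ?_
  have h1 : M.mechFactor a (Function.update z k t) =
      M.mech a (z a) fun j => Function.update z k t j := by
    rw [mechFactor, Function.update_of_ne hk.symm]
  rw [h1]
  refine AdditiveNoise.mech_eq M hN (w := fun j => z j)
    (C := Real.log (M.mechFactor b (Function.update z k t)) - Real.log (M.mechFactor b z))
    (fun u => ?_) (z a)
  have h2 := h (Function.update z a u) t
  rw [Function.update_comm hk.symm, M.mechFactor_update_self, M.mechFactor_update_self,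
    M.mechFactor_update_of_notMem hab ha, M.mechFactor_update_of_notMem hab ha] at h2
  linarith

/-- No cancellation of two mechanisms at a variable on which one of them depends. -/
theorem exists_log_mechFactor_sub_ne (hN : M.AdditiveNoise) (hF : M.AdjacencyFaithful)
    {a b k : Fin n} (hab : a ≠ b) (hkb : k ≠ b) (hka : k ∈ M.graph.pa a) :
    ¬ ∀ z t, Real.log (M.mechFactor a (Function.update z k t)) -
        Real.log (M.mechFactor b (Function.update z k t)) =
      Real.log (M.mechFactor a z) - Real.log (M.mechFactor b z) := by
  intro h
  -- If `a` is a parent of `b`, acyclicity allows the roles to be exchanged when `k` is also a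
  -- parent of `b`; otherwise `p_b` does not see `z_k`.
  by_cases ha : a ∈ M.graph.pa b
  · by_cases hk : k ∈ M.graph.pa b
    · refine M.exists_log_mechFactor_sub_ne_of_notMem hN hF hab.symm
        (M.graph.not_mem_pa_of_mem_pa ha) hk fun z t => ?_
      linarith [h z t]
    · obtain ⟨z, t, hne⟩ := AdjacencyFaithful.exists_update_ne M hF hka
      have h1 := h z t
      rw [M.mechFactor_update_of_notMem hkb hk] at h1
      exact hne (Real.log_injOn_pos (M.mechFactor_pos _ _) (M.mechFactor_pos _ _) (by linarith))
  · exact M.exists_log_mechFactor_sub_ne_of_notMem hN hF hab ha hka h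

/-! ### The data in the coordinates of a diagonal encoder -/

/-- The encoder `h` recovers the variable `target m` in coordinate `m`, up to the diffeomorphism
`φ m` with inverse `c m`. -/
structure Recovers (h : (Fin d → ℝ) → (Fin n → ℝ)) (φ c : Fin n → ℝ → ℝ) : Prop where
  measurable : ∀ m, Measurable (φ m)
  measurable_inv : ∀ m, Measurable (c m)
  left_inv : ∀ m u, c m (φ m u) = u
  right_inv : ∀ m u, φ m (c m u) = u
  eq_permMap : h ∘ M.g = permMap M.target φ
  isDiffeoPair : IsDiffeoPair (h ∘ M.g) fun y l => c (M.target.symm l) (y (M.target.symm l))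

/-- The latent graph with its nodes numbered like the environments. -/
def envGraph : DAG n := M.graph.relabel M.target

variable {M} {h : (Fin d → ℝ) → (Fin n → ℝ)} {φ c : Fin n → ℝ → ℝ}

namespace Recovers

theorem latE_eq (R : M.Recovers h φ c) (m : Fin n) : M.data.latE h m =
    (factorLaw (M.intFactor (M.q (M.target m)) (M.target m))).map (permMap M.target φ) := by
  rw [M.latE_eq R.isDiffeoPair.contDiff.continuous.measurable, M.lawE_eq_factorLaw, R.eq_permMap]

theorem latE'_eq (R : M.Recovers h φ c) (m : Fin n) : M.data.latE' h m =
    (factorLaw (M.intFactor (M.q' (M.target m)) (M.target m))).map (permMap M.target φ) := by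
  rw [M.latE'_eq R.isDiffeoPair.contDiff.continuous.measurable, M.lawE'_eq_factorLaw,
    R.eq_permMap]

/-- The local Markov property for `Ẑ`. The factor of `j` is determined without its parents if `j` is
intervened, and by `S` otherwise; parents of `j` and roots other than `j` are non-descendants of
`j`. -/
theorem coordCondIndep_map (R : M.Recovers h φ c) {r : ℝ → ℝ} (hr : IsSmoothPosPDF r)
    {m j k : Fin n} {S : Set (Fin n)} (hS : S ⊆ M.envGraph.pa j)
    (hj : j = m ∨ (M.envGraph.pa j : Set (Fin n)) ⊆ S)
    (hk : k ∈ M.envGraph.pa j ∨ (M.envGraph.pa k = ∅ ∧ k ≠ j)) :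
    CoordCondIndep
      ((factorLaw (M.intFactor r (M.target m))).map (permMap M.target φ)) k j S := by
  rw [coordCondIndep_map_permMap_iff R.measurable R.measurable_inv R.left_inv R.right_inv]
  refine (M.markovFactors_intFactor _ hr).coordCondIndep ?_ ?_ ?_
  · by_cases hjm : j = m
    · subst hjm
      exact (M.dependsOn_intFactor_self _ r).mono (by simp)
    · rw [M.intFactor_of_ne _ r (M.target.injective.ne hjm)]
      refine (M.dependsOn_mechFactor _).mono (Set.insert_subset_insert fun l hl => ?_)
      refine ⟨M.target.symm l, hj.resolve_left hjm ?_, by simp⟩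
      exact (M.graph.mem_relabel_pa M.target).2 (by simpa using hl)
  · rintro _ ⟨l, hl, rfl⟩
    exact M.graph.not_reach_of_mem_pa ((M.graph.mem_relabel_pa M.target).1 (hS hl))
  · rcases hk with hk | ⟨hk, hkj⟩
    · exact M.graph.not_reach_of_mem_pa ((M.graph.mem_relabel_pa M.target).1 hk)
    · exact M.graph.not_reach_of_pa_eq_empty ((M.graph.relabel_pa_eq_empty M.target).1 hk)
        (M.target.injective.ne hkj)

/-- An intervention away from `j` keeps the mechanism of `j`, which depends on `k`; independence
would contradict the converse of the Markov property. This transfers dependence from the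
observational law to the environments. -/
theorem not_coordCondIndep_map (R : M.Recovers h φ c) (hF : M.AdjacencyFaithful) {r : ℝ → ℝ}
    (hr : IsSmoothPosPDF r) {m j k : Fin n} (hjm : j ≠ m) (hk : k ∈ M.envGraph.pa j) :
    ¬ CoordCondIndep ((factorLaw (M.intFactor r (M.target m))).map (permMap M.target φ)) k j
      ((M.envGraph.pa j : Set (Fin n)) \ {k}) := by
  rw [coordCondIndep_map_permMap_iff R.measurable R.measurable_inv R.left_inv R.right_inv]
  intro hCI
  have hk' := (M.graph.mem_relabel_pa M.target).1 hk
  obtain ⟨z, t, hne⟩ := AdjacencyFaithful.exists_update_ne M hF hk'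
  have hfac : M.intFactor r (M.target m) (M.target j) = M.mechFactor (M.target j) :=
    M.intFactor_of_ne _ r (M.target.injective.ne hjm)
  have := (M.markovFactors_intFactor (M.target m) hr).update_eq_of_coordCondIndep ?_ ?_
    (M.graph.not_reach_of_mem_pa hk') ?_ hCI z t
  · rw [hfac] at this
    exact hne this
  · rw [hfac]
    refine (M.dependsOn_mechFactor _).mono (Set.insert_subset_insert fun l hl => ?_)
    by_cases hlk : l = M.target k
    · exact Or.inl hlk
    · refine Or.inr ⟨M.target.symm l, ⟨?_, ?_⟩, by simp⟩
      · exact (M.graph.mem_relabel_pa M.target).2 (by simpa using hl)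
      · rintro rfl
        simp at hlk
  · rintro _ ⟨l, hl, rfl⟩
    exact M.graph.not_reach_of_mem_pa ((M.graph.mem_relabel_pa M.target).1 hl.1)
  · rintro ⟨l, hl, hlk⟩
    exact hl.2 (M.target.injective hlk)

theorem scoreChange_eq_zero_iff (R : M.Recovers h φ c) (i j k : Fin n) :
    scoreChange (M.data.latE h i) (M.data.latE' h j) k = 0 ↔ ∀ (z : Fin n → ℝ) (t : ℝ),
      (fun z => Real.log (M.q (M.target i) (z (M.target i))) -
        Real.log (M.mechFactor (M.target i) z) -
        (Real.log (M.q' (M.target j) (z (M.target j))) -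
          Real.log (M.mechFactor (M.target j) z))) (Function.update z (M.target k) t) =
      (fun z => Real.log (M.q (M.target i) (z (M.target i))) -
        Real.log (M.mechFactor (M.target i) z) -
        (Real.log (M.q' (M.target j) (z (M.target j))) -
          Real.log (M.mechFactor (M.target j) z))) z := by
  have hlog : ∀ z, Real.log (M.intPDF (M.q (M.target i)) (M.target i) z) -
      Real.log (M.intPDF (M.q' (M.target j)) (M.target j) z) =
      (fun z => Real.log (M.q (M.target i) (z (M.target i))) -
        Real.log (M.mechFactor (M.target i) z) -
        (Real.log (M.q' (M.target j) (z (M.target j))) -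
          Real.log (M.mechFactor (M.target j) z))) z := fun z => by
    rw [M.log_intPDF _ (M.q_pdf _), M.log_intPDF _ (M.q'_pdf _)]
    ring
  rw [M.scoreChange_eq_zero_iff R.isDiffeoPair]
  have hupd : ∀ (y : Fin n → ℝ) t, (fun l => c (M.target.symm l)
      (Function.update y k t (M.target.symm l))) =
      Function.update (fun l => c (M.target.symm l) (y (M.target.symm l))) (M.target k)
        (c k t) := by
    intro y t
    funext l
    obtain ⟨m, rfl⟩ := M.target.surjective l
    by_cases hm : m = k
    · subst hm; simp
    · simp [hm]
  simp only [hlog, hupd]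
  constructor
  · intro H z t
    have := H (fun m => φ m (z (M.target m))) (φ k t)
    simpa [R.left_inv] using this
  · intro H y t
    exact H _ _

theorem mem_pairSet_iff (R : M.Recovers h φ c) (hD : M.Discrepancy) (hN : M.AdditiveNoise)
    (hF : M.AdjacencyFaithful) {i j : Fin n} (hij : i ≠ j) (k : Fin n) :
    k ∈ M.data.pairSet h i j ↔
      k = i ∨ k = j ∨ k ∈ M.envGraph.pa i ∨ k ∈ M.envGraph.pa j := by
  have hIij : M.target i ≠ M.target j := M.target.injective.ne hij
  -- Adding the two mismatched differences cancels both mechanisms. As a function of `z_i` only `log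
  -- (q_i / q̃_i)` is left, which is not constant.
  have hself : ∀ i j : Fin n, i ≠ j →
      (scoreChange (M.data.latE h i) (M.data.latE' h j) i = 0) →
      (scoreChange (M.data.latE h j) (M.data.latE' h i) i = 0) → False := by
    intro i j hij h1 h2
    rw [R.scoreChange_eq_zero_iff] at h1 h2
    have hIij : M.target j ≠ M.target i := M.target.injective.ne hij.symm
    have h3 := (hD (M.target i)).eq_of_log_sub_log_eq (M.q_pdf _).pos (M.q'_pdf _).pos
      continuous_id (fun s t => by
        have a1 := h1 0 s
        have a2 := h2 0 s
        have b1 := h1 0 t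
        have b2 := h2 0 t
        simp only [Function.update_self, Function.update_of_ne hIij] at a1 a2 b1 b2
        simp only [id]
        linarith) 0 1
    simp at h3
  have hother : ∀ k, k ≠ i → k ≠ j → ((scoreChange (M.data.latE h i) (M.data.latE' h j) k = 0 ↔
      ∀ z t, Real.log (M.mechFactor (M.target i) (Function.update z (M.target k) t)) -
        Real.log (M.mechFactor (M.target j) (Function.update z (M.target k) t)) =
      Real.log (M.mechFactor (M.target i) z) - Real.log (M.mechFactor (M.target j) z)) ∧
      (scoreChange (M.data.latE h j) (M.data.latE' h i) k = 0 ↔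
      ∀ z t, Real.log (M.mechFactor (M.target i) (Function.update z (M.target k) t)) -
        Real.log (M.mechFactor (M.target j) (Function.update z (M.target k) t)) =
      Real.log (M.mechFactor (M.target i) z) - Real.log (M.mechFactor (M.target j) z))) := by
    intro k hki hkj
    have e1 : M.target i ≠ M.target k := M.target.injective.ne hki.symm
    have e2 : M.target j ≠ M.target k := M.target.injective.ne hkj.symm
    rw [R.scoreChange_eq_zero_iff, R.scoreChange_eq_zero_iff]
    simp only [Function.update_of_ne e1, Function.update_of_ne e2]
    exact ⟨forall₂_congr fun z t => ⟨fun H => by linarith, fun H => by linarith⟩,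
      forall₂_congr fun z t => ⟨fun H => by linarith, fun H => by linarith⟩⟩
  simp only [Data.pairSet, Set.mem_ofPred_eq]
  by_cases hki : k = i
  · subst hki
    simp only [true_or, iff_true]
    by_contra! hcon
    exact hself k j hij hcon.1 hcon.2
  by_cases hkj : k = j
  · subst hkj
    simp only [true_or, or_true, iff_true]
    by_contra! hcon
    exact hself k i hij.symm hcon.2 hcon.1
  obtain ⟨o1, o2⟩ := hother k hki hkj
  rw [Ne, Ne, o1, o2, or_self]
  simp only [hki, hkj, false_or, envGraph, M.graph.mem_relabel_pa]
  constructor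
  · intro H
    by_contra! hcon
    refine H fun z t => ?_
    rw [M.mechFactor_update_of_notMem (M.target.injective.ne hki) hcon.1,
      M.mechFactor_update_of_notMem (M.target.injective.ne hkj) hcon.2]
  · rintro (hk | hk)
    · exact M.exists_log_mechFactor_sub_ne hN hF hIij (M.target.injective.ne hkj) hk
    · intro H
      refine M.exists_log_mechFactor_sub_ne hN hF hIij.symm (M.target.injective.ne hki) hk
        fun z t => ?_
      linarith [H z t]

end Recovers

end Model

namespace Model.Recovers

variable {n d : ℕ} {M : Model n d} {h : (Fin d → ℝ) → (Fin n → ℝ)} {φ c : Fin n → ℝ → ℝ}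

/-! ### Correctness of the estimated graph -/

theorem pairSet_eq_pair (R : M.Recovers h φ c) (hD : M.Discrepancy) (hN : M.AdditiveNoise)
    (hF : M.AdjacencyFaithful) {i j : Fin n} (hij : i ≠ j) (hi : M.envGraph.pa i = ∅)
    (hj : ∀ l ∈ M.envGraph.pa j, l = i) : M.data.pairSet h i j = {i, j} := by
  ext k
  rw [R.mem_pairSet_iff hD hN hF hij, hi]
  constructor
  · rintro (hk | hk | hk | hk)
    · exact Or.inl hk
    · exact Or.inr hk
    · exact absurd hk (Finset.notMem_empty _)
    · exact Or.inl (hj k hk)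
  · rintro (hk | hk)
    · exact Or.inl hk
    · exact Or.inr (Or.inl hk)

theorem pa_subset_of_ncard_pairSet (R : M.Recovers h φ c) (hD : M.Discrepancy)
    (hN : M.AdditiveNoise) (hF : M.AdjacencyFaithful) {i j : Fin n} (hij : i ≠ j)
    (hcard : (M.data.pairSet h i j).ncard = 2) :
    (∀ l ∈ M.envGraph.pa i, l = j) ∧ ∀ l ∈ M.envGraph.pa j, l = i := by
  have hmem := R.mem_pairSet_iff hD hN hF hij
  have hsub : ({i, j} : Set (Fin n)) ⊆ M.data.pairSet h i j := by
    rintro k (rfl | rfl)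
    · exact (hmem _).2 (Or.inl rfl)
    · exact (hmem _).2 (Or.inr (Or.inl rfl))
  have heq := Set.eq_of_subset_of_ncard_le hsub
    (by rw [hcard, Set.ncard_pair hij]) (Set.toFinite _)
  constructor
  · intro l hl
    have h1 : l ∈ ({i, j} : Set (Fin n)) := heq ▸ (hmem l).2 (Or.inr (Or.inr (Or.inl hl)))
    rcases h1 with rfl | h1
    · exact absurd hl (M.envGraph.notMem_pa_self _)
    · exact h1
  · intro l hl
    have h1 : l ∈ ({i, j} : Set (Fin n)) := heq ▸ (hmem l).2 (Or.inr (Or.inr (Or.inr hl)))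
    rcases h1 with h1 | rfl
    · exact h1
    · exact absurd hl (M.envGraph.notMem_pa_self _)

theorem coe_pa_diff_eq_empty {i j : Fin n} (hj : ∀ l ∈ M.envGraph.pa j, l = i) :
    (M.envGraph.pa j : Set (Fin n)) \ {i} = ∅ :=
  Set.sdiff_eq_empty.2 fun l hl => hj l hl

/-- A pair set of size two leaves at most one edge, between `i` and `j`. An edge `i → j` gives
dependence when `i` is intervened, no edge gives independence in both environments, and `j → i`
gives independence when `i` is intervened but dependence when `j` is. -/
theorem declaredRoot_iff (R : M.Recovers h φ c) (hD : M.Discrepancy) (hN : M.AdditiveNoise)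
    (hF : M.AdjacencyFaithful) {i : Fin n} (hi : ∃ j, j ≠ i) :
    M.data.DeclaredRoot h i ↔ M.envGraph.pa i = ∅ := by
  constructor
  · rintro ⟨j, hji, hcard, hdep⟩
    obtain ⟨hpi, hpj⟩ := R.pa_subset_of_ncard_pairSet hD hN hF hji.symm hcard
    rw [Finset.eq_empty_iff_forall_notMem]
    intro l hl
    obtain rfl := hpi l hl
    rcases hdep with hdep | ⟨-, hdep⟩
    · refine hdep (CoordCondIndep.symm ?_)
      rw [R.latE_eq]
      exact R.coordCondIndep_map (M.q_pdf _) (Set.empty_subset _) (Or.inl rfl) (Or.inl hl)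
    · rw [R.latE'_eq] at hdep
      have h1 := R.not_coordCondIndep_map hF (M.q'_pdf (M.target l)) hji.symm hl
      rw [coe_pa_diff_eq_empty hpi] at h1
      exact h1 hdep.symm
  · intro hroot
    -- A source among the remaining nodes has no parent except possibly `i`, so with the root `i` it
    -- forms a pair set of size two.
    obtain ⟨j, hji, hsrc⟩ := M.envGraph.exists_source (T := {j | j ≠ i}) hi
    have hji' : j ≠ i := hji
    have hpj : ∀ l ∈ M.envGraph.pa j, l = i := fun l hl => by
      by_contra hli
      exact hsrc l hli hl
    refine ⟨j, hji', ?_, ?_⟩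
    · rw [R.pairSet_eq_pair hD hN hF hji'.symm hroot hpj, Set.ncard_pair hji'.symm]
    · by_cases hij : i ∈ M.envGraph.pa j
      · left
        rw [R.latE_eq]
        have h1 := R.not_coordCondIndep_map hF (M.q_pdf (M.target i)) hji' hij
        rwa [coe_pa_diff_eq_empty hpj] at h1
      · right
        have hemp : (M.envGraph.pa j : Set (Fin n)) ⊆ ∅ := fun l hl =>
          absurd (hpj l hl ▸ hl) hij
        rw [R.latE_eq, R.latE'_eq]
        exact ⟨R.coordCondIndep_map (M.q_pdf _) (Set.empty_subset _) (Or.inr hemp)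
            (Or.inr ⟨hroot, hji'.symm⟩),
          R.coordCondIndep_map (M.q'_pdf _) (Set.empty_subset _) (Or.inr hemp)
            (Or.inr ⟨hroot, hji'.symm⟩)⟩

theorem self_mem_interSet (R : M.Recovers h φ c) (hD : M.Discrepancy) (hN : M.AdditiveNoise)
    (hF : M.AdjacencyFaithful) (j : Fin n) : j ∈ M.data.interSet h j :=
  fun _ hij => (R.mem_pairSet_iff hD hN hF hij.symm j).2 (Or.inl rfl)

theorem pa_subset_interSet (R : M.Recovers h φ c) (hD : M.Discrepancy) (hN : M.AdditiveNoise)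
    (hF : M.AdjacencyFaithful) {j k : Fin n} (hk : k ∈ M.envGraph.pa j) :
    k ∈ M.data.interSet h j :=
  fun _ hij => (R.mem_pairSet_iff hD hN hF hij.symm k).2 (Or.inr (Or.inr (Or.inl hk)))

/-- A spurious element `k` of `ℬ_j` can enter the pair set of `j` and a third node `i` only as a
parent of `i`. -/
theorem mem_pa_of_mem_interSet (R : M.Recovers h φ c) (hD : M.Discrepancy)
    (hN : M.AdditiveNoise) (hF : M.AdjacencyFaithful) {j k i : Fin n}
    (hk : k ∈ M.data.interSet h j) (hkj : k ≠ j) (hkpa : k ∉ M.envGraph.pa j) (hij : i ≠ j)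
    (hik : i ≠ k) : k ∈ M.envGraph.pa i := by
  rcases (R.mem_pairSet_iff hD hN hF hij.symm k).1 (hk i hij) with h1 | h1 | h1 | h1
  · exact absurd h1 hkj
  · exact absurd h1.symm hik
  · exact absurd h1 hkpa
  · exact h1

/-- A spurious element other than `k` would be a parent of the root `k`. Hence the conditioning set
of the final test is the true one. -/
theorem interSet_diff_eq (R : M.Recovers h φ c) (hD : M.Discrepancy)
    (hN : M.AdditiveNoise) (hF : M.AdjacencyFaithful) {j k : Fin n}
    (hroot : M.envGraph.pa k = ∅) (hkj : k ≠ j) :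
    M.data.interSet h j \ {j, k} = (M.envGraph.pa j : Set (Fin n)) \ {k} := by
  ext l
  simp only [Set.mem_sdiff, Set.mem_insert_iff, Set.mem_singleton_iff, not_or, Finset.mem_coe]
  constructor
  · rintro ⟨hl, hlj, hlk⟩
    refine ⟨?_, hlk⟩
    by_contra hlpa
    have := R.mem_pa_of_mem_interSet hD hN hF hl hlj hlpa hkj (Ne.symm hlk)
    rw [hroot] at this
    exact absurd this (Finset.notMem_empty _)
  · rintro ⟨hl, hlk⟩
    refine ⟨R.pa_subset_interSet hD hN hF hl, ?_, hlk⟩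
    rintro rfl
    exact M.envGraph.notMem_pa_self _ hl

/-- A spurious `k` belongs to every `ℬ_i`, and so does `i` itself, so `ℬ_i` has two elements unless
`i = k`. -/
theorem singletonSet_subset (R : M.Recovers h φ c) (hD : M.Discrepancy)
    (hN : M.AdditiveNoise) (hF : M.AdjacencyFaithful) {j k : Fin n}
    (hk : k ∈ M.data.interSet h j) (hkj : k ≠ j) (hkpa : k ∉ M.envGraph.pa j) :
    M.data.singletonSet h ⊆ {k} := by
  intro i hi
  by_contra hik
  have hik' : i ≠ k := hik
  obtain ⟨a, ha⟩ := Set.ncard_eq_one.1 hi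
  have h1 : i ∈ M.data.interSet h i := R.self_mem_interSet hD hN hF i
  have h2 : k ∈ M.data.interSet h i := by
    by_cases hij : i = j
    · rw [hij]; exact hk
    · exact R.pa_subset_interSet hD hN hF
        (R.mem_pa_of_mem_interSet hD hN hF hk hkj hkpa hij hik')
  rw [ha] at h1 h2
  exact hik' (h1.trans h2.symm)

theorem graphEstimate_adj_iff (R : M.Recovers h φ c) (hD : M.Discrepancy)
    (hN : M.AdditiveNoise) (hF : M.AdjacencyFaithful) (k j : Fin n) :
    (M.data.graphEstimate h).Adj k j ↔ k ∈ M.envGraph.pa j := by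
  constructor
  · rintro ⟨hkj, hk, hor⟩
    by_contra hkpa
    rcases hor with hcard | ⟨hjroot, hdep⟩
    · have h1 := Set.ncard_le_ncard (R.singletonSet_subset hD hN hF hk hkj hkpa)
      rw [Set.ncard_singleton] at h1
      omega
    · have hne : ∀ i : Fin n, ∃ l, l ≠ i := fun i => by
        by_cases hik : i = k
        · exact ⟨j, hik ▸ hkj.symm⟩
        · exact ⟨k, Ne.symm hik⟩
      rw [R.declaredRoot_iff hD hN hF (hne j)] at hjroot
      -- A spurious `k` is a parent of all nodes except `j` and `k`, and `j` is not a root; so any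
      -- root must be `k`.
      have honly : ∀ i, M.envGraph.pa i = ∅ → i = k := by
        intro i hi
        by_contra hik
        have hij : i ≠ j := by
          rintro rfl
          exact hjroot hi
        have := R.mem_pa_of_mem_interSet hD hN hF hk hkj hkpa hij hik
        rw [hi] at this
        exact absurd this (Finset.notMem_empty _)
      have hkroot : M.envGraph.pa k = ∅ := by
        obtain ⟨r, -, hr⟩ := M.envGraph.exists_source (T := Set.univ) ⟨k, trivial⟩
        have hr' : M.envGraph.pa r = ∅ :=
          Finset.eq_empty_iff_forall_notMem.2 fun l => hr l trivial
        rwa [honly r hr'] at hr'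
      refine hdep (fun i => ?_) ?_
      · rw [R.declaredRoot_iff hD hN hF (hne i)]
        exact ⟨honly i, fun hi => hi ▸ hkroot⟩
      · rw [R.interSet_diff_eq hD hN hF hkroot hkj, R.latE_eq]
        refine R.coordCondIndep_map (M.q_pdf _) Set.sdiff_subset (Or.inr fun l hl => ⟨hl, ?_⟩)
          (Or.inr ⟨hkroot, hkj⟩)
        rintro rfl
        exact hkpa hl
  · intro hk
    have hkj : k ≠ j := by
      rintro rfl
      exact M.envGraph.notMem_pa_self _ hk
    -- A true edge always passes the second alternative, whatever the number of singletons.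
    refine ⟨hkj, R.pa_subset_interSet hD hN hF hk, Or.inr ⟨?_, fun honly => ?_⟩⟩
    · rw [R.declaredRoot_iff hD hN hF ⟨k, hkj⟩]
      intro hj
      rw [hj] at hk
      exact absurd hk (Finset.notMem_empty _)
    · have hkroot := (R.declaredRoot_iff hD hN hF ⟨j, hkj.symm⟩).1 ((honly k).2 rfl)
      rw [R.interSet_diff_eq hD hN hF hkroot hkj, R.latE_eq]
      exact R.not_coordCondIndep_map hF (M.q_pdf _) hkj.symm hk

theorem perfectDAGRecovery (R : M.Recovers h φ c) (hD : M.Discrepancy)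
    (hN : M.AdditiveNoise) (hF : M.AdjacencyFaithful) :
    PerfectDAGRecovery M (M.data.graphEstimate h) := by
  refine ⟨M.target.symm, fun i j => ?_⟩
  rw [R.graphEstimate_adj_iff hD hN hF, envGraph, M.graph.mem_relabel_pa]
  simp [DAG.toDigraph]

end Model.Recovers

theorem Data.IsOptimalEncoder.perfect_recovery {n d : ℕ} {M : Model n d} (hD : M.Discrepancy)
    {h : (Fin d → ℝ) → (Fin n → ℝ)} (hopt : M.data.IsOptimalEncoder h) :
    PerfectLatentRecovery M h ∧ (M.AdditiveNoise → M.TwiceDifferentiable →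
      M.AdjacencyFaithful → PerfectDAGRecovery M (M.data.graphEstimate h)) := by
  refine ⟨M.perfectLatentRecovery hD hopt.1 hopt.2.1, fun hN _ hF => ?_⟩
  obtain ⟨φ, c, hφ, hc, hcφ, hφc, hψ, H⟩ := M.exists_eq_permMap hD hopt.1 hopt.2.1
  have R : M.Recovers h φ c := ⟨fun m => (hφ m).continuous.measurable,
    fun m => (hc m).continuous.measurable, hcφ, hφc, hψ, H⟩
  exact R.perfectDAGRecovery hD hN hF

end CausalRep

/-! ### The theorem. -/

open CausalRep in
theorem theorem3 (n d : ℕ) :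
    -- identifiability: the interventional data alone determine the latents and the graph
    (∃ (recZ : Data n d → (Fin d → ℝ) → (Fin n → ℝ)) (recG : Data n d → Digraph (Fin n)),
      ∀ M : Model n d, M.Discrepancy →
        PerfectLatentRecovery M (recZ M.data) ∧
        (M.AdditiveNoise → M.TwiceDifferentiable → M.AdjacencyFaithful →
          PerfectDAGRecovery M (recG M.data))) ∧
    -- achievability: the recovery algorithm has a solution, and every solution is perfect
    (∀ M : Model n d, M.Discrepancy →
      (∃ h, M.data.IsOptimalEncoder h) ∧
      ∀ h, M.data.IsOptimalEncoder h →
        PerfectLatentRecovery M h ∧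
        (M.AdditiveNoise → M.TwiceDifferentiable → M.AdjacencyFaithful →
          PerfectDAGRecovery M (M.data.graphEstimate h))) := by
  classical
  -- The estimators choose an optimal encoder from the data alone; the defaults `0` and `⊥` are
  -- never reached on data of a model with discrepancy.
  refine ⟨⟨fun D => if hD : ∃ h, D.IsOptimalEncoder h then hD.choose else 0,
    fun D => if hD : ∃ h, D.IsOptimalEncoder h then D.graphEstimate hD.choose else ⊥,
    fun M hM => ?_⟩, fun M hM => ⟨M.exists_isOptimalEncoder hM, fun h hopt =>
      hopt.perfect_recovery hM⟩⟩
  have hex := M.exists_isOptimalEncoder hM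
  simp only [dif_pos hex]
  exact hex.choose_spec.perfect_recovery hM
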